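/- A group $G$ is called divisible (respectively uniquely divisible) if for every nonzero integer $n$ the map $G\to G$, $g\mapsto g^n$, is surjective (respectively bijective). For a group $G$, let $\eta_G\colon G\to \mathsf{Bau}(G)$ be its Baumslag rationalization, i.e. the universal homomorphism from $G$ to a uniquely divisible group, and let $\mathsf{CBau}(G)=\mathrm{Coker}(\eta_G)$ be the quotient of $\mathsf{Bau}(G)$ by the normal closure of the image of $\eta_G$. A group $H$ is a subquotient of a group $K$ if $H\cong S/N$ for some subgroup $S\le K$ and some normal subgroup $N$ of $S$. Let $\varphi\colon X\to G$ be a map from a set $X$ to a divisible group $G$ such that every element of $\varphi(X)$ is a torsion element (has finite order). Then the subgroup $\langle\varphi(X)\rangle$ of $G$ generated by $\varphi(X)$ is a subquotient of $\mathsf{CBau}(F(X))$, where $F(X)$ is the free group generated by $X$. -/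

import Mathlib

universe u v

/-- A group is divisible if `g ↦ g ^ n` is surjective for every nonzero integer `n`. -/
def IsDivisibleGroup (G : Type u) [Group G] : Prop :=
  ∀ n : ℤ, n ≠ 0 → Function.Surjective (fun g : G => g ^ n)

/-- A group is uniquely divisible (a `ℚ`-group) if `g ↦ g ^ n` is bijective for every nonzero
integer `n`. -/
def IsUniquelyDivisibleGroup (G : Type u) [Group G] : Prop :=
  ∀ n : ℤ, n ≠ 0 → Function.Bijective (fun g : G => g ^ n)

/-- Agreement with Mathlib's notion of divisibility for multiplicative groups. -/
theorem isDivisibleGroup_iff (G : Type u) [Group G] :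
    IsDivisibleGroup G ↔ Nonempty (RootableBy G ℤ) :=
  ⟨fun h => ⟨rootableByOfPowLeftSurj G ℤ fun {n} hn => h n hn⟩,
    fun ⟨_⟩ _ hn => RootableBy.surjective_pow G ℤ hn⟩

/-- Formal expressions built from elements of `G` with the group operations and a formal `n`-th
root for every `n ≥ 1`. -/
inductive BauTerm (G : Type u) : Type u
  | of (g : G) : BauTerm G
  | one : BauTerm G
  | mul (a b : BauTerm G) : BauTerm G
  | inv (a : BauTerm G) : BauTerm G
  | root (n : ℕ+) (a : BauTerm G) : BauTerm G

namespace BauTerm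

/-- The formal power `a ^ k`. -/
def pow {G : Type u} (a : BauTerm G) : ℕ → BauTerm G
  | 0 => one
  | k + 1 => mul (pow a k) a

/-- The congruence on formal expressions generated by the group axioms, the multiplication table
of `G`, and the axioms saying that `root n` is a two-sided inverse of the `n`-th power map. -/
inductive Rel {G : Type u} [Group G] : BauTerm G → BauTerm G → Prop
  | refl (a : BauTerm G) : Rel a a
  | symm {a b : BauTerm G} : Rel a b → Rel b a
  | trans {a b c : BauTerm G} : Rel a b → Rel b c → Rel a c
  | mul_congr {a a' b b' : BauTerm G} : Rel a a' → Rel b b' → Rel (mul a b) (mul a' b')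
  | inv_congr {a a' : BauTerm G} : Rel a a' → Rel (inv a) (inv a')
  | root_congr (n : ℕ+) {a a' : BauTerm G} : Rel a a' → Rel (root n a) (root n a')
  | mul_assoc (a b c : BauTerm G) : Rel (mul (mul a b) c) (mul a (mul b c))
  | one_mul (a : BauTerm G) : Rel (mul one a) a
  | inv_mul_cancel (a : BauTerm G) : Rel (mul (inv a) a) one
  | of_mul (g h : G) : Rel (of (g * h)) (mul (of g) (of h))
  | root_pow (n : ℕ+) (a : BauTerm G) : Rel (pow (root n a) n) a
  | pow_root (n : ℕ+) (a : BauTerm G) : Rel (root n (pow a n)) a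

/-- The congruence `Rel` as a setoid. -/
def relSetoid (G : Type u) [Group G] : Setoid (BauTerm G) :=
  ⟨Rel, ⟨Rel.refl, Rel.symm, Rel.trans⟩⟩

end BauTerm

/-- The Baumslag rationalization of `G`: the group with unique roots presented by `G`. Its
universal property is `Bau.isUniquelyDivisible` together with `Bau.existsUnique_lift`. -/
def Bau (G : Type u) [Group G] : Type u := Quotient (BauTerm.relSetoid G)

namespace Bau

/-- The class of a formal expression. -/
def mk {G : Type u} [Group G] (a : BauTerm G) : Bau G := Quotient.mk (BauTerm.relSetoid G) a

/-- The multiplication of `Bau G`. -/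
instance instMul (G : Type u) [Group G] : Mul (Bau G) :=
  ⟨Quotient.map₂ BauTerm.mul fun _ _ h _ _ h' => BauTerm.Rel.mul_congr h h'⟩

/-- The unit of `Bau G`. -/
instance instOne (G : Type u) [Group G] : One (Bau G) := ⟨mk BauTerm.one⟩

/-- The inverse of `Bau G`. -/
instance instInv (G : Type u) [Group G] : Inv (Bau G) :=
  ⟨Quotient.map BauTerm.inv fun _ _ h => BauTerm.Rel.inv_congr h⟩

/-- The group structure of `Bau G`. -/
instance instGroup (G : Type u) [Group G] : Group (Bau G) :=
  Group.ofLeftAxioms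
    (by
      rintro ⟨a⟩ ⟨b⟩ ⟨c⟩
      exact Quotient.sound (BauTerm.Rel.mul_assoc a b c))
    (by
      rintro ⟨a⟩
      exact Quotient.sound (BauTerm.Rel.one_mul a))
    (by
      rintro ⟨a⟩
      exact Quotient.sound (BauTerm.Rel.inv_mul_cancel a))

/-- The universal homomorphism `η_G : G → Bau G`. -/
def eta (G : Type u) [Group G] : G →* Bau G :=
  MonoidHom.mk' (fun g => mk (BauTerm.of g)) fun g h => Quotient.sound (BauTerm.Rel.of_mul g h)

theorem mk_pow {G : Type u} [Group G] (a : BauTerm G) (k : ℕ) : mk (a.pow k) = mk a ^ k := by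
  induction k with
  | zero => exact (pow_zero _).symm
  | succ k ih => rw [pow_succ, ← ih]; rfl

/-- `Bau G` is uniquely divisible. -/
theorem isUniquelyDivisible (G : Type u) [Group G] : IsUniquelyDivisibleGroup (Bau G) := by
  have key : ∀ n : ℕ, 0 < n → Function.Bijective (fun g : Bau G => g ^ n) := by
    intro n hn
    let r : Bau G → Bau G :=
      Quotient.map (BauTerm.root ⟨n, hn⟩) fun _ _ h => BauTerm.Rel.root_congr _ h
    refine Function.bijective_iff_has_inverse.mpr ⟨r, ?_, ?_⟩
    · rintro ⟨a⟩
      change r (mk a ^ n) = mk a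
      rw [← mk_pow]
      exact Quotient.sound (BauTerm.Rel.pow_root ⟨n, hn⟩ a)
    · rintro ⟨a⟩
      change mk (BauTerm.root ⟨n, hn⟩ a) ^ n = mk a
      rw [← mk_pow]
      exact Quotient.sound (BauTerm.Rel.root_pow ⟨n, hn⟩ a)
  intro n hn
  have hb := key n.natAbs (Int.natAbs_pos.mpr hn)
  rcases Int.natAbs_eq n with h | h
  · rw [h]
    simpa only [zpow_natCast] using hb
  · rw [h]
    simp only [zpow_neg, zpow_natCast]
    exact (Equiv.inv (Bau G)).bijective.comp hb

theorem bijective_pow {H : Type v} [Group H] (hH : IsUniquelyDivisibleGroup H) (n : ℕ+) :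
    Function.Bijective (fun h : H => h ^ (n : ℕ)) := by
  have h := hH (n : ℕ) (by exact_mod_cast n.ne_zero)
  simpa only [zpow_natCast] using h

/-- The value of a formal expression in a uniquely divisible group. -/
noncomputable def valueIn {G : Type u} {H : Type v} [Group G] [Group H]
    (hH : IsUniquelyDivisibleGroup H) (f : G →* H) : BauTerm G → H
  | .of g => f g
  | .one => 1
  | .mul a b => valueIn hH f a * valueIn hH f b
  | .inv a => (valueIn hH f a)⁻¹
  | .root n a => (Equiv.ofBijective _ (bijective_pow hH n)).symm (valueIn hH f a)

theorem valueIn_pow {G : Type u} {H : Type v} [Group G] [Group H]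
    (hH : IsUniquelyDivisibleGroup H) (f : G →* H) (a : BauTerm G) (k : ℕ) :
    valueIn hH f (a.pow k) = valueIn hH f a ^ k := by
  induction k with
  | zero => exact (pow_zero _).symm
  | succ k ih => rw [pow_succ, ← ih]; rfl

theorem valueIn_rel {G : Type u} {H : Type v} [Group G] [Group H]
    (hH : IsUniquelyDivisibleGroup H) (f : G →* H) {a b : BauTerm G} (h : BauTerm.Rel a b) :
    valueIn hH f a = valueIn hH f b := by
  induction h with
  | refl a => rfl
  | symm _ ih => exact ih.symm
  | trans _ _ ih ih' => exact ih.trans ih'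
  | mul_congr _ _ ih ih' => simp only [valueIn, ih, ih']
  | inv_congr _ ih => simp only [valueIn, ih]
  | root_congr n _ ih => simp only [valueIn, ih]
  | mul_assoc a b c => simp only [valueIn, mul_assoc]
  | one_mul a => simp only [valueIn, one_mul]
  | inv_mul_cancel a => simp only [valueIn, inv_mul_cancel]
  | of_mul g h => simp only [valueIn, map_mul]
  | root_pow n a =>
    rw [valueIn_pow]
    exact (Equiv.ofBijective _ (bijective_pow hH n)).apply_symm_apply (valueIn hH f a)
  | pow_root n a =>
    simp only [valueIn]
    rw [valueIn_pow]
    exact (Equiv.ofBijective _ (bijective_pow hH n)).symm_apply_apply (valueIn hH f a)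

/-- Every homomorphism from `G` to a uniquely divisible group (in any universe) factors uniquely
through `η_G`. -/
theorem existsUnique_lift {G : Type u} {H : Type v} [Group G] [Group H]
    (hH : IsUniquelyDivisibleGroup H) (f : G →* H) :
    ∃! F : Bau G →* H, F.comp (eta G) = f := by
  refine ⟨MonoidHom.mk' (Quotient.lift (valueIn hH f) fun _ _ h => valueIn_rel hH f h) ?_,
    ?_, ?_⟩
  · rintro ⟨a⟩ ⟨b⟩
    rfl
  · ext g
    rfl
  · intro F hF
    have key : ∀ a : BauTerm G, F (mk a) = valueIn hH f a := by
      intro a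
      induction a with
      | of g => exact DFunLike.congr_fun hF g
      | one => exact map_one F
      | mul a b iha ihb =>
        change F (mk a * mk b) = _
        rw [map_mul, iha, ihb]
        rfl
      | inv a ih =>
        change F (mk a)⁻¹ = _
        rw [map_inv, ih]
        rfl
      | root n a ih =>
        refine (bijective_pow hH n).injective ?_
        change F (mk (a.root n)) ^ (n : ℕ) =
          Equiv.ofBijective _ (bijective_pow hH n)
            ((Equiv.ofBijective _ (bijective_pow hH n)).symm (valueIn hH f a))
        rw [Equiv.apply_symm_apply, ← ih, ← map_pow, ← mk_pow]
        exact congrArg F (Quotient.sound (BauTerm.Rel.root_pow n a))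
    ext x
    obtain ⟨a⟩ := x
    exact key a

end Bau

/-- The cokernel of `η_G : G → Bau G`: the quotient of `Bau G` by the normal closure of the image
of `η_G`. -/
abbrev CBau (G : Type u) [Group G] : Type u :=
  Bau G ⧸ Subgroup.normalClosure ((Bau.eta G).range : Set (Bau G))

/-- `H` is a subquotient of `K`: it is isomorphic to the quotient of a subgroup of `K` by a normal
subgroup of that subgroup. -/
def IsSubquotient (H : Type u) (K : Type v) [Group H] [Group K] : Prop :=
  ∃ (S : Subgroup K) (N : Subgroup S) (_ : N.Normal), Nonempty ((S ⧸ N) ≃* H)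

/-! Suppose `φ` lifts to `s : X → U` along `p : U →* G` with `U` uniquely divisible. Sending `x` to
`s x ^ orderOf (φ x)` extends to `E : Bau (FreeGroup X) →* U`, and `p ∘ E` kills the image of `η`,
so it factors through `CBau`. The root of order `orderOf (φ x)` of `η x` goes to `s x`, by
uniqueness of roots in `U`, and then to `φ x`. Thus the image of `CBau` contains every `φ x`, and
the preimage of the generated subgroup gives the subquotient.

It remains to construct `U`. Begin with a free product of copies of `ℚ`, one for each `x`, mapped to
`G` using divisibility. This group is tame: it is torsion-free, and centralizers of nontrivial
elements are cyclic or are commutative with all roots of the element available. Given a tame group,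
choose one self-centralizing generator from each class under conjugacy up to inversion and glue a
copy of `ℚ` along the cyclic group it generates. Every old element acquires roots, and the map to
`G` extends (`IsTameGroup.exists_adjoin_roots`). Tame groups have unique roots, so iterating and
taking the direct limit yields `U`.

The main point is that gluing preserves tameness (`StarAmalgam.isTameGroup`). The new group acts on
its Bass-Serre tree, and malnormality of the edge groups says that a nontrivial element fixes at
most one edge at each central vertex. Hence the centralizer of a nontrivial element either fixes a
vertex, so that it is inherited from a vertex group, or belongs to a translation and embeds in `ℤ`.
-/

/-! ### Four-point metrics and centralizers of translations -/

/-- A distance with values in `ℕ` satisfying the four-point condition. -/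
structure IsFourPointDist {V : Type*} (d : V → V → ℕ) : Prop where
  eq_of_eq_zero : ∀ a b, d a b = 0 → a = b
  self : ∀ a, d a a = 0
  symm : ∀ a b, d a b = d b a
  triangle : ∀ a b c, d a c ≤ d a b + d b c
  four_point : ∀ a b c e, d a b + d c e ≤ max (d a c + d b e) (d a e + d b c)

/-- The centralizer of `x` is cyclic. -/
def HasCyclicCentralizer {M : Type*} [Group M] (x : M) : Prop :=
  ∃ c : M, ∀ y, Commute x y ↔ y ∈ Subgroup.zpowers c

theorem exists_eventually_eq_of_antitone (f : ℕ → ℕ) (hf : ∀ n, f (n + 1) ≤ f n) :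
    ∃ N c, ∀ n, N ≤ n → f n = c := by
  have ha : Antitone f := antitone_nat_of_succ_le hf
  obtain ⟨N, hN⟩ : ∃ N, ∀ n, f N ≤ f n :=
    ⟨Function.argmin f, fun n => Function.argmin_le f n⟩
  exact ⟨N, f N, fun n hn => le_antisymm (ha hn) (hN n)⟩

namespace IsFourPointDist

variable {V M : Type*} [Group M] [MulAction M V] {d : V → V → ℕ} {x : M} {v : V} {k : ℕ}

/-- An isometry commuting with a translation `x` of length `k` along the orbit of `v` shifts that
orbit by a fixed amount `t`. -/
theorem exists_shift (hd : IsFourPointDist d) (hM : ∀ (g : M) a b, d (g • a) (g • b) = d a b)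
    (hk : 0 < k) (hx : ∀ n : ℕ, d v (x ^ n • v) = n * k) {y : M} (hy : Commute x y) :
    ∃ (t : ℤ) (N : ℕ), ∀ j : ℕ, N ≤ j →
      (d v (x ^ j • y • v) : ℤ) = j * k + t ∧ (d (x ^ j • v) (y • v) : ℤ) = j * k - t := by
  have hxy : ∀ n : ℕ, y • x ^ n • v = x ^ n • y • v := fun n => by
    rw [smul_smul, smul_smul, (hy.pow_left n).eq]
  set D := d v (y • v) with hD
  have lowP : ∀ j : ℕ, j * k ≤ d v (x ^ j • y • v) + D := fun j => by
    have := hd.triangle v (x ^ j • y • v) (x ^ j • v)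
    rw [hx, hM, hd.symm (y • v)] at this
    exact this
  have lowN : ∀ j : ℕ, j * k ≤ d (x ^ j • v) (y • v) + D := fun j => by
    have := hd.triangle v (y • v) (x ^ j • v)
    rw [hx, hd.symm (y • v)] at this
    omega
  have hx1 : d v (x • v) = k := by simpa using hx 1
  have decP : ∀ j : ℕ, d v (x ^ (j + 1) • y • v) ≤ d v (x ^ j • y • v) + k := fun j => by
    have := hd.triangle v (x • v) (x ^ (j + 1) • y • v)
    rw [pow_succ', mul_smul, hM, hx1] at this
    rw [pow_succ', mul_smul]
    omega
  have decN : ∀ j : ℕ, d (x ^ (j + 1) • v) (y • v) ≤ d (x ^ j • v) (y • v) + k := fun j => by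
    have := hd.triangle (x ^ (j + 1) • v) (x ^ j • v) (y • v)
    rw [pow_succ, mul_smul, hM, hd.symm (x • v), hx1] at this
    rw [pow_succ, mul_smul]
    omega
  obtain ⟨N₁, a, ha⟩ := exists_eventually_eq_of_antitone
    (fun j => d v (x ^ j • y • v) + D - j * k) (fun j => by
      have h1 := lowP j; have h2 := lowP (j + 1); have h3 := decP j
      simp only [add_mul, one_mul] at h2 ⊢
      omega)
  obtain ⟨N₂, b, hb⟩ := exists_eventually_eq_of_antitone
    (fun j => d (x ^ j • v) (y • v) + D - j * k) (fun j => by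
      have h1 := lowN j; have h2 := lowN (j + 1); have h3 := decN j
      simp only [add_mul, one_mul] at h2 ⊢
      omega)
  have haP : ∀ j, N₁ ≤ j → d v (x ^ j • y • v) + D = j * k + a := fun j hj => by
    have h1 := lowP j; have h2 := ha j hj
    omega
  have hbN : ∀ j, N₂ ≤ j → d (x ^ j • v) (y • v) + D = j * k + b := fun j hj => by
    have h1 := lowN j; have h2 := hb j hj
    omega
  -- The triangle inequality gives `≥` and the four-point condition gives `≤`. Pairing `y v` with `x
  -- y v` makes one term of the maximum smaller than the left side by `2 * k`, which rules that term
  -- out.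
  have hab : a + b = 2 * D := by
    set N := max N₁ N₂
    have e1 := haP N (le_max_left _ _)
    have e2 := haP (N + 2) (by omega)
    have e3 := hbN N (le_max_right _ _)
    have e4 := hbN (N + 1) (by omega)
    -- the four points are `x⁻¹ ^ (N + 1) v`, `x ^ (N + 1) v`, `y v` and `x y v`, shifted by
    -- `x ^ (N + 1)`
    have f := hd.four_point (x ^ (N + 1) • y • v) (x ^ (N + 1) • x ^ (N + 1) • v)
      (x ^ (N + 1) • x • y • v) v
    have g1 : d (x ^ (N + 1) • y • v) (x ^ (N + 1) • x ^ (N + 1) • v)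
        = d (x ^ (N + 1) • v) (y • v) := by rw [hM, hd.symm]
    have g2 : d (x ^ (N + 1) • x • y • v) v = d v (x ^ (N + 2) • y • v) := by
      rw [hd.symm, smul_smul, ← pow_succ]
    have g3 : d (x ^ (N + 1) • y • v) (x ^ (N + 1) • x • y • v) = k := by
      have : x • y • v = y • x • v := by simpa using (hxy 1).symm
      rw [hM, this, hM, hx1]
    have g4 : d (x ^ (N + 1) • x ^ (N + 1) • v) v = (N + 1 + (N + 1)) * k := by
      rw [smul_smul, ← pow_add, hd.symm, hx]
    have e5 := haP (N + 1) (by omega)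
    have g5 : d (x ^ (N + 1) • y • v) v = d v (x ^ (N + 1) • y • v) := hd.symm _ _
    have g6 : d (x ^ (N + 1) • x ^ (N + 1) • v) (x ^ (N + 1) • x • y • v)
        = d (x ^ N • v) (y • v) := by
      rw [hM, pow_succ', mul_smul, hM]
    have tri := hd.triangle v (x ^ (N + 1) • y • v) (x ^ (N + 1) • x ^ (N + 1) • v)
    rw [hd.symm v (x ^ (N + 1) • x ^ (N + 1) • v), g4, g1] at tri
    rw [g1, g2, g3, g4, g5, g6] at f
    simp only [add_mul, one_mul] at e2 e4 e5 f tri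
    omega
  refine ⟨a - D, max N₁ N₂, fun j hj => ⟨?_, ?_⟩⟩
  · have := haP j ((le_max_left _ _).trans hj)
    zify at this
    linarith
  · have := hbN j ((le_max_right _ _).trans hj)
    zify at this hab
    linarith

/-- The shift `t` is an additive map from the centralizer to `ℤ`. An element of shift zero fixes
`v`, hence is trivial by `hfix`, so the centralizer embeds in `ℤ`. -/
theorem hasCyclicCentralizer (hd : IsFourPointDist d)
    (hM : ∀ (g : M) a b, d (g • a) (g • b) = d a b)
    (hk : 0 < k) (hx : ∀ n : ℕ, d v (x ^ n • v) = n * k)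
    (hfix : ∀ y, Commute x y → y • v = v → y = 1) : HasCyclicCentralizer x := by
  choose! t N ht using fun y (hy : Commute x y) => hd.exists_shift hM hk hx hy
  have hc : ∀ y, Commute x y → ∀ (n : ℕ) (w : V), y • x ^ n • w = x ^ n • y • w := by
    intro y hy n w
    rw [← mul_smul, ← mul_smul, (hy.pow_left n).eq]
  -- Distances seen from the backward end make `t` subadditive; those seen from the forward end make
  -- it superadditive.
  have hadd : ∀ y z, Commute x y → Commute x z → t (y * z) = t y + t z := by
    intro y z hy hz
    have hyz := hy.mul_right hz
    set n := N y + N z + N (y * z)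
    have a1 := (ht y hy n (by omega))
    have a2 := (ht z hz n (by omega))
    have a3 := (ht _ hyz (n + n) (by omega))
    have t1 := hd.triangle v (x ^ n • y • v) (x ^ n • y • x ^ n • z • v)
    rw [hM, hM, hc y hy, smul_smul (x ^ n), ← pow_add, ← mul_smul y] at t1
    have t2 := hd.triangle (x ^ n • x ^ n • v) (y • x ^ n • v) (y • z • v)
    rw [hc y hy, hM, ← hc y hy, hM, smul_smul (x ^ n), ← pow_add, ← mul_smul y] at t2
    zify at t1 t2
    push_cast at a3
    linarith [a1.1, a1.2, a2.1, a2.2, a3.1, a3.2]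
  have hzero : ∀ y, Commute x y → t y = 0 → y = 1 := by
    intro y hy h0
    refine hfix y hy (hd.eq_of_eq_zero _ _ ?_)
    set n := N y
    have a1 := ht y hy n le_rfl
    -- Both `x ^ n • y • v` and `x ^ n • v` are midpoints of `v` and `x ^ (2 * n) • v`, and
    -- midpoints are unique.
    have f := hd.four_point (x ^ n • y • v) (x ^ n • v) (x ^ n • x ^ n • v) v
    have g1 : d (x ^ n • x ^ n • v) v = (n + n) * k := by
      rw [smul_smul, ← pow_add, hd.symm, hx]
    rw [hM, hM, hM, g1, hd.symm (y • v) (x ^ n • v), hd.symm (x ^ n • v) v, hx,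
      hd.symm (x ^ n • y • v) v] at f
    rw [h0] at a1
    have b1 : d v (x ^ n • y • v) = n * k := by zify; linarith [a1.1]
    have b2 : d (x ^ n • v) (y • v) = n * k := by zify; linarith [a1.2]
    rw [b1, b2, add_mul] at f
    omega
  let τ : Subgroup.centralizer {x} →* Multiplicative ℤ :=
    MonoidHom.mk' (fun y => Multiplicative.ofAdd (t y)) (fun y z => by
      have hy := Subgroup.mem_centralizer_singleton_iff.mp y.2
      have hz := Subgroup.mem_centralizer_singleton_iff.mp z.2
      rw [← ofAdd_add, ← hadd _ _ (Eq.symm hy) (Eq.symm hz)]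
      rfl)
  have hinj : Function.Injective τ := by
    rw [injective_iff_map_eq_one]
    intro y hy
    have hy' := Subgroup.mem_centralizer_singleton_iff.mp y.2
    exact Subtype.ext (hzero _ (Eq.symm hy') hy)
  obtain ⟨c, hc⟩ := (isCyclic_of_injective τ hinj).exists_generator
  refine ⟨c, fun y => ⟨fun hy => ?_, ?_⟩⟩
  · obtain ⟨n, hn⟩ := hc ⟨y, Subgroup.mem_centralizer_singleton_iff.mpr hy.eq.symm⟩
    exact ⟨n, congrArg Subtype.val hn⟩
  · rintro ⟨n, rfl⟩
    exact Commute.zpow_right (Eq.symm (Subgroup.mem_centralizer_singleton_iff.mp c.2)) n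

end IsFourPointDist

/-! ### Geometry of trees and group actions on them -/

namespace SimpleGraph.IsTree

variable {V M : Type*} {T : SimpleGraph V}

theorem exists_adj_dist_add_one (hT : T.IsTree) {a b : V} (h : a ≠ b) :
    ∃ w, T.Adj a w ∧ T.dist w b + 1 = T.dist a b := by
  obtain ⟨p, hp⟩ := hT.connected.exists_walk_length_eq_dist a b
  cases p with
  | nil => exact absurd rfl h
  | @cons _ w _ hw q =>
    refine ⟨w, hw, ?_⟩
    have h1 := SimpleGraph.dist_le q
    have h2 := hT.connected.dist_triangle (u := a) (v := w) (w := b)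
    rw [SimpleGraph.dist_eq_one_iff_adj.mpr hw] at h2
    rw [SimpleGraph.Walk.length_cons] at hp
    omega

theorem dist_adj_cases (hT : T.IsTree) (a : V) {e f : V} (h : T.Adj e f) :
    T.dist a f = T.dist a e + 1 ∨ T.dist a f + 1 = T.dist a e := by
  have h1 := hT.dist_ne_of_adj a h
  have h2 := h.diff_dist_adj (u := a)
  omega

theorem eq_of_adj_of_dist (hT : T.IsTree) {r v w w' : V} (hw : T.Adj v w) (hw' : T.Adj v w')
    (h : T.dist r w + 1 = T.dist r v) (h' : T.dist r w' + 1 = T.dist r v) : w = w' := by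
  obtain ⟨p, hp⟩ := hT.connected.exists_walk_length_eq_dist r w
  obtain ⟨q, hq⟩ := hT.connected.exists_walk_length_eq_dist r w'
  have hp' : (p.concat hw.symm).IsPath :=
    SimpleGraph.Walk.isPath_of_length_eq_dist _ (by rw [SimpleGraph.Walk.length_concat]; omega)
  have hq' : (q.concat hw'.symm).IsPath :=
    SimpleGraph.Walk.isPath_of_length_eq_dist _ (by rw [SimpleGraph.Walk.length_concat]; omega)
  have := congrArg (fun P : T.Path r v => P.1.penultimate)
    ((hT.isAcyclic.subsingleton_path r v).elim ⟨_, hp'⟩ ⟨_, hq'⟩)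
  simpa using this

/-- Once a geodesic towards `c` starts to recede from `a`, it recedes for ever: the only neighbour
of `f` closer to `a` is `e`, and the geodesic does not turn back. -/
theorem dist_eq_add_of_adj (hT : T.IsTree) (a c : V) : ∀ (n : ℕ) (e f : V), T.dist c e = n →
    T.Adj e f → T.dist c f + 1 = T.dist c e → T.dist a f = T.dist a e + 1 →
    T.dist a c = T.dist a e + T.dist e c := by
  intro n
  induction n with
  | zero => intro e f hn _ h1 _; omega
  | succ n ih =>
    intro e f hn hef h1 h2
    have hfe := SimpleGraph.dist_eq_one_iff_adj.mpr hef
    by_cases hcf : f = c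
    · subst hcf
      rw [hfe, h2]
    · obtain ⟨g, hg, hgc⟩ := hT.exists_adj_dist_add_one hcf
      rw [SimpleGraph.dist_comm, SimpleGraph.dist_comm (u := f)] at hgc
      rcases hT.dist_adj_cases a hg with h3 | h3
      · rw [ih f g (by omega) hg hgc h3, h2, SimpleGraph.dist_comm (u := f),
          SimpleGraph.dist_comm (u := e)]
        omega
      · have := hT.eq_of_adj_of_dist hg hef.symm h3 h2.symm
        subst this
        omega

/-- Move `e` one step towards `c`. If this recedes from `a` or `b`, then `e` lies on a geodesic from
that point to `c` and the triangle inequality suffices. Otherwise three distances drop by one and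
induction applies. -/
theorem dist_four_point (hT : T.IsTree) (a b c : V) : ∀ (n : ℕ) (e : V), T.dist c e = n →
    T.dist a b + T.dist c e ≤ max (T.dist a c + T.dist b e) (T.dist a e + T.dist b c) := by
  intro n
  induction n with
  | zero =>
    intro e hn
    have := (hT.connected.dist_eq_zero_iff).mp hn
    subst this
    have := hT.connected.dist_triangle (u := a) (v := c) (w := b)
    rw [SimpleGraph.dist_comm (u := c) (v := b)] at this
    simp only [SimpleGraph.dist_self]
    omega
  | succ n ih =>
    intro e hn
    have hne : e ≠ c := by
      rintro rfl
      simp at hn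
    obtain ⟨f, hf, hfc⟩ := hT.exists_adj_dist_add_one hne
    rw [SimpleGraph.dist_comm, SimpleGraph.dist_comm (u := e)] at hfc
    have key := ih f (by omega)
    have t1 := hT.connected.dist_triangle (u := a) (v := e) (w := b)
    rw [SimpleGraph.dist_comm (u := e) (v := b)] at t1
    rcases hT.dist_adj_cases a hf with h1 | h1
    · have := hT.dist_eq_add_of_adj a c _ e f rfl hf hfc h1
      rw [SimpleGraph.dist_comm (u := e)] at this
      omega
    · rcases hT.dist_adj_cases b hf with h2 | h2
      · have := hT.dist_eq_add_of_adj b c _ e f rfl hf hfc h2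
        rw [SimpleGraph.dist_comm (u := e)] at this
        omega
      · omega

theorem isFourPointDist (hT : T.IsTree) : IsFourPointDist T.dist where
  eq_of_eq_zero _ _ h := hT.connected.dist_eq_zero_iff.mp h
  self _ := SimpleGraph.dist_self
  symm _ _ := SimpleGraph.dist_comm
  triangle _ _ _ := hT.connected.dist_triangle
  four_point a b c e := hT.dist_four_point a b c _ e rfl

variable [Group M] [MulAction M V]

theorem dist_smul_smul (hT : T.IsTree) (hadj : ∀ (g : M) a b, T.Adj a b → T.Adj (g • a) (g • b))
    (g : M) (a b : V) : T.dist (g • a) (g • b) = T.dist a b := by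
  have key : ∀ (g : M) (a b : V), T.dist (g • a) (g • b) ≤ T.dist a b := by
    intro g a b
    obtain ⟨p, hp⟩ := hT.connected.exists_walk_length_eq_dist a b
    rw [← hp, ← SimpleGraph.Walk.length_map ⟨fun v => g • v, fun {a b} h => hadj g a b h⟩ p]
    exact SimpleGraph.dist_le _
  refine le_antisymm (key g a b) ?_
  simpa using key g⁻¹ (g • a) (g • b)

theorem smul_eq_of_dist_add_dist (hT : T.IsTree)
    (hadj : ∀ (g : M) a b, T.Adj a b → T.Adj (g • a) (g • b)) {x : M} {a b w : V}
    (ha : x • a = a) (hb : x • b = b) (hw : T.dist a w + T.dist w b = T.dist a b) :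
    x • w = w := by
  have f := hT.isFourPointDist.four_point (x • w) w a b
  have h1 := hT.dist_smul_smul hadj x w a
  have h2 := hT.dist_smul_smul hadj x w b
  rw [ha] at h1
  rw [hb] at h2
  rw [h1, h2, SimpleGraph.dist_comm (u := w) (v := a)] at f
  exact hT.isFourPointDist.eq_of_eq_zero _ _ (by omega)

/-- An element moving every vertex of a tree on which the group acts without inversions
translates along some orbit. -/
theorem exists_translation (hT : T.IsTree)
    (hadj : ∀ (g : M) a b, T.Adj a b → T.Adj (g • a) (g • b)) {x : M}
    (hinv : ∀ v, ¬ T.Adj v (x • v)) (hx : ∀ v : V, x • v ≠ v) :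
    ∃ v, 0 < T.dist v (x • v) ∧ ∀ n : ℕ, T.dist v (x ^ n • v) = n * T.dist v (x • v) := by
  have hd := hT.isFourPointDist
  have hM := hT.dist_smul_smul hadj
  have : Nonempty V := hT.connected.nonempty
  set v := Function.argmin (fun v => T.dist v (x • v)) with hv
  have hmin : ∀ w, T.dist v (x • v) ≤ T.dist w (x • w) :=
    fun w => Function.argmin_le (fun v => T.dist v (x • v)) w
  clear_value v
  have hpos : 0 < T.dist v (x • v) := hT.connected.pos_dist_of_ne (hx v).symm
  have hne1 : T.dist v (x • v) ≠ 1 := fun h => hinv v (SimpleGraph.dist_eq_one_iff_adj.mp h)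
  set k := T.dist v (x • v) with hk
  -- If the geodesics from `x • v` to `v` and to `x • x • v` shared their first edge, to `w`, then
  -- `x⁻¹ • w` would be displaced by less than the minimum `k`. This needs `k ≠ 1`, the absence of
  -- inversions.
  have h2 : T.dist v (x • x • v) = 2 * k := by
    obtain ⟨w, hw, hwc⟩ := hT.exists_adj_dist_add_one (hx v)
    have hwv : T.dist v w + 1 = k := by
      rw [hk, SimpleGraph.dist_comm, hwc, SimpleGraph.dist_comm]
    rcases hT.dist_adj_cases (x • x • v) hw with h1 | h1
    · have := hT.dist_eq_add_of_adj (x • x • v) v _ (x • v) w rfl hw (by rw [hwv]) h1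
      rw [hM, SimpleGraph.dist_comm (u := x • v), ← hk] at this
      rw [SimpleGraph.dist_comm, this, two_mul]
    · have e1 : T.dist (x • x • v) (x • v) = k := by rw [hM, SimpleGraph.dist_comm]
      have f := hd.four_point (x⁻¹ • w) w v (x • v)
      have g1 : T.dist (x⁻¹ • w) v = T.dist w (x • v) := by
        rw [← hM x, smul_inv_smul]
      have g2 : T.dist w (x • v) = 1 :=
        SimpleGraph.dist_eq_one_iff_adj.mpr hw.symm
      have g3 : T.dist (x⁻¹ • w) (x • v) = T.dist (x • x • v) w := by
        rw [← hM x, smul_inv_smul, SimpleGraph.dist_comm]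
      have m := hmin (x⁻¹ • w)
      rw [smul_inv_smul] at m
      rw [g1, g2, g3, SimpleGraph.dist_comm (u := w) (v := v), ← hk] at f
      omega
  refine ⟨v, hpos, fun n => ?_⟩
  induction n using Nat.twoStepInduction with
  | zero => simp
  | one => simp
  | more n ih1 ih2 =>
    have f := hd.four_point v (x ^ (n + 1) • v) (x ^ n • v) (x ^ (n + 2) • v)
    have e1 : T.dist (x ^ n • v) (x ^ (n + 2) • v) = 2 * k := by
      rw [pow_add, mul_smul, hM, ← h2, pow_two, mul_smul]
    have e2 : T.dist (x ^ (n + 1) • v) (x ^ (n + 2) • v) = k := by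
      rw [pow_succ x (n + 1), mul_smul, hM]
    have e3 : T.dist (x ^ (n + 1) • v) (x ^ n • v) = k := by
      rw [pow_succ x n, mul_smul, hM, SimpleGraph.dist_comm]
    have t := hd.triangle v (x ^ (n + 1) • v) (x ^ (n + 2) • v)
    rw [ih1, ih2, e1, e2, e3] at f
    rw [ih2, e2] at t
    simp only [add_mul, one_mul] at f t ⊢
    omega

/-- Centralizers of elements of a group acting on a bipartite tree in such a way that a nontrivial
element fixes at most one edge at each black vertex. -/
theorem centralizer_trichotomy (hT : T.IsTree)
    (hadj : ∀ (g : M) a b, T.Adj a b → T.Adj (g • a) (g • b)) {black : V → Prop}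
    (hcol : ∀ a b, T.Adj a b → (black a ↔ ¬ black b))
    (hblack : ∀ (g : M) a, black (g • a) ↔ black a)
    (hedge : ∀ (x : M) b w w', black b → T.Adj b w → T.Adj b w' → w ≠ w' →
      x • b = b → x • w = w → x • w' = w' → x = 1) {x : M} (hx : x ≠ 1) :
    (∃ w, ¬ black w ∧ ∀ y, Commute x y → y • w = w) ∨
    (∃ b, black b ∧ ∀ y, Commute x y → y • b = b) ∨
    (HasCyclicCentralizer x ∧ ∀ n : ℕ, n ≠ 0 → x ^ n ≠ 1) := by
  have hstep : ∀ (y : M) (a b : V), a ≠ b → y • a = a → y • b = b →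
      ∃ w, T.Adj a w ∧ T.dist w b + 1 = T.dist a b ∧ y • w = w := by
    intro y a b hab ha hb
    obtain ⟨w, hw, hwb⟩ := hT.exists_adj_dist_add_one hab
    refine ⟨w, hw, hwb, hT.smul_eq_of_dist_add_dist hadj ha hb ?_⟩
    rw [SimpleGraph.dist_eq_one_iff_adj.mpr hw]
    omega
  have hwhite : ∀ (y : M) (w w' : V), ¬ black w → ¬ black w' → w ≠ w' → y • w = w → y • w' = w' →
      y = 1 := by
    intro y w w' hw hw' hne h h'
    obtain ⟨b, hb, hd, hyb⟩ := hstep y w w' hne h h'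
    have hbb : black b := by
      have := hcol _ _ hb
      tauto
    obtain ⟨u, hu, hd', hyu⟩ := hstep y b w' (by rintro rfl; exact hw' hbb) hyb h'
    refine hedge y b w u hbb hb.symm hu ?_ hyb h hyu
    rintro rfl
    omega
  have hcomm : ∀ (y : M) (a : V), Commute x y → x • a = a → x • y • a = y • a := by
    intro y a hy ha
    rw [smul_smul, hy.eq, mul_smul, ha]
  -- A centralizing `y` permutes the fixed vertices of `x`. There is at most one fixed white vertex;
  -- if there is none, a fixed black vertex is unique, since a geodesic between two would contain a
  -- fixed white one.
  by_cases h1 : ∃ w, ¬ black w ∧ x • w = w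
  · obtain ⟨w, hw, hxw⟩ := h1
    refine Or.inl ⟨w, hw, fun y hy => ?_⟩
    by_contra hne
    exact hx (hwhite x (y • w) w (by rwa [hblack]) hw hne (hcomm y w hy hxw) hxw)
  right
  by_cases h2 : ∃ b : V, x • b = b
  · obtain ⟨b, hxb⟩ := h2
    refine Or.inl ⟨b, by_contra fun h => h1 ⟨b, h, hxb⟩, fun y hy => ?_⟩
    by_contra hne
    have hbb : black b := by_contra fun h => h1 ⟨b, h, hxb⟩
    obtain ⟨w, hw, -, hxw⟩ := hstep x b (y • b) (Ne.symm hne) hxb (hcomm y b hy hxb)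
    exact h1 ⟨w, (hcol _ _ hw).mp hbb, hxw⟩
  right
  push Not at h2
  obtain ⟨v, hk, hv⟩ := hT.exists_translation hadj (x := x)
    (fun v h => by have := hcol _ _ h; rw [hblack] at this; tauto) h2
  refine ⟨hT.isFourPointDist.hasCyclicCentralizer (hT.dist_smul_smul hadj) hk hv ?_, ?_⟩
  · intro y hy hyv
    have hyx : y • x • v = x • v := by rw [smul_smul, ← hy.eq, mul_smul, hyv]
    have hyxx : y • x • x • v = x • x • v := by rw [smul_smul, ← hy.eq, mul_smul, hyx]
    -- Since `v` and `x • x • v` are `2 * k` apart, the geodesics to them leave `x • v` by distinct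
    -- edges, both fixed by `y`. For white `v`, two fixed white vertices suffice.
    by_cases hbv : black v
    · obtain ⟨w, hw, hd, hyw⟩ := hstep y (x • v) v (h2 v) hyx hyv
      obtain ⟨w', hw', hd', hyw'⟩ := hstep y (x • v) (x • x • v) (h2 _).symm hyx hyxx
      refine hedge y (x • v) w w' (by rwa [hblack]) hw hw' ?_ hyx hyw hyw'
      rintro rfl
      have e := hv 2
      have t := hT.connected.dist_triangle (u := v) (v := w) (w := x • x • v)
      rw [pow_two, mul_smul] at e
      rw [hT.dist_smul_smul hadj] at hd'
      rw [SimpleGraph.dist_comm (u := w), SimpleGraph.dist_comm (u := x • v)] at hd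
      omega
    · exact hwhite y v (x • v) hbv (by rwa [hblack]) (h2 v).symm hyv hyx
  · intro n hn h
    have := hv n
    rw [h, one_smul, SimpleGraph.dist_self] at this
    exact (Nat.mul_pos (Nat.pos_of_ne_zero hn) hk).ne this

end SimpleGraph.IsTree

/-! ### Normal forms in amalgamated products -/

open Monoid


/-- The two factors of an amalgamated product, indexed by `Bool`. -/
def AmalgamFactor (A H : Type u) : Bool → Type u
  | true => A
  | false => H

instance AmalgamFactor.instGroup (A H : Type u) [Group A] [Group H] :
    ∀ b, Group (AmalgamFactor A H b)
  | true => inferInstanceAs (Group A)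
  | false => inferInstanceAs (Group H)

/-- An element of `A` as an element of the first factor. -/
def AmalgamFactor.ofLeft {A H : Type u} (a : A) : AmalgamFactor A H true := a

/-- An element of `H` as an element of the second factor. -/
def AmalgamFactor.ofRight {A H : Type u} (h : H) : AmalgamFactor A H false := h

/-- The two maps defining an amalgamated product, indexed by `Bool`. -/
def amalgamMap {A H : Type u} {B : Type v} [Group A] [Group H] [Group B] (α : B →* A)
    (β : B →* H) : ∀ b, B →* AmalgamFactor A H b
  | true => α
  | false => β

/-- The amalgamated product of `A` and `H` over `B`. -/
abbrev Amalgam {A H : Type u} {B : Type v} [Group A] [Group H] [Group B] (α : B →* A)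
    (β : B →* H) : Type (max u v) := PushoutI (amalgamMap α β)

namespace Amalgam

variable {A H : Type u} {B : Type v} [Group A] [Group H] [Group B] (α : B →* A) (β : B →* H)

/-- The first factor of an amalgamated product. -/
def inl : A →* Amalgam α β := PushoutI.of (φ := amalgamMap α β) true

/-- The second factor of an amalgamated product. -/
def inr : H →* Amalgam α β := PushoutI.of (φ := amalgamMap α β) false

theorem inl_comp_eq (b : B) : inl α β (α b) = inr α β (β b) :=
  (PushoutI.of_apply_eq_base (amalgamMap α β) true b).trans
    (PushoutI.of_apply_eq_base (amalgamMap α β) false b).symm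

variable {α β}

theorem amalgamMap_injective (hα : Function.Injective α) (hβ : Function.Injective β) :
    ∀ b, Function.Injective (amalgamMap α β b)
  | true => hα
  | false => hβ

theorem inl_injective (hα : Function.Injective α) (hβ : Function.Injective β) :
    Function.Injective (inl α β) :=
  PushoutI.of_injective (amalgamMap_injective hα hβ) true

theorem inr_injective (hα : Function.Injective α) (hβ : Function.Injective β) :
    Function.Injective (inr α β) :=
  PushoutI.of_injective (amalgamMap_injective hα hβ) false

/-- The elements of an amalgamated product given by reduced words starting in `A`. -/
inductive StartsInl : Amalgam α β → Prop
  | single (a : A) : a ∉ α.range → StartsInl (inl α β a)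
  | pair (a : A) (h : H) : a ∉ α.range → h ∉ β.range → StartsInl (inl α β a * inr α β h)
  | cons (a : A) (h : H) (k : Amalgam α β) : a ∉ α.range → h ∉ β.range → StartsInl k →
      StartsInl (inl α β a * inr α β h * k)

theorem StartsInl.exists_reduced {k : Amalgam α β} (hk : StartsInl k) :
    ∃ w : CoprodI.Word (AmalgamFactor A H), PushoutI.Reduced (amalgamMap α β) w ∧
      w.fstIdx = some true ∧ PushoutI.ofCoprodI w.prod = k := by
  have hl : ∀ {a : A}, a ∉ α.range → AmalgamFactor.ofLeft (H := H) a ≠ 1 := by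
    intro a ha h1
    exact ha (by rw [show a = 1 from h1]; exact one_mem _)
  have hr : ∀ {h : H}, h ∉ β.range → AmalgamFactor.ofRight (A := A) h ≠ 1 := by
    intro a ha h1
    exact ha (by rw [show a = 1 from h1]; exact one_mem _)
  have key : ∀ (w : CoprodI.Word (AmalgamFactor A H)), PushoutI.Reduced (amalgamMap α β) w →
      w.fstIdx ≠ some false → ∀ (a : A) (h : H), a ∉ α.range → h ∉ β.range →
      ∃ w' : CoprodI.Word (AmalgamFactor A H), PushoutI.Reduced (amalgamMap α β) w' ∧
        w'.fstIdx = some true ∧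
        PushoutI.ofCoprodI w'.prod = inl α β a * inr α β h * PushoutI.ofCoprodI w.prod := by
    intro w hw hw1 a h ha hh
    refine ⟨CoprodI.Word.cons (i := true) (.ofLeft a)
      (CoprodI.Word.cons (i := false) (.ofRight h) w hw1 (hr hh))
      (by rw [CoprodI.Word.fstIdx_cons]; simp) (hl ha), ?_, CoprodI.Word.fstIdx_cons .., ?_⟩
    · intro g hg
      simp only [CoprodI.Word.cons, List.mem_cons] at hg
      rcases hg with rfl | rfl | hg
      · exact ha
      · exact hh
      · exact hw g hg
    · rw [CoprodI.Word.prod_cons, CoprodI.Word.prod_cons, map_mul, map_mul, PushoutI.ofCoprodI_of,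
        PushoutI.ofCoprodI_of, mul_assoc]
      rfl
  induction hk with
  | single a ha =>
    have h0 : (CoprodI.Word.empty : CoprodI.Word (AmalgamFactor A H)).fstIdx ≠ some true := by
      simp [CoprodI.Word.fstIdx, CoprodI.Word.empty]
    refine ⟨CoprodI.Word.cons (i := true) (.ofLeft a) .empty h0 (hl ha), ?_,
      CoprodI.Word.fstIdx_cons .., ?_⟩
    · intro g hg
      simp only [CoprodI.Word.cons, CoprodI.Word.empty, List.mem_cons, List.not_mem_nil,
        or_false] at hg
      rcases hg with rfl
      exact ha
    · rw [CoprodI.Word.prod_cons, CoprodI.Word.prod_empty, mul_one, PushoutI.ofCoprodI_of]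
      rfl
  | pair a h ha hh =>
    obtain ⟨w, h1, h2, h3⟩ := key .empty (by intro g hg; simp [CoprodI.Word.empty] at hg)
      (by simp [CoprodI.Word.fstIdx, CoprodI.Word.empty]) a h ha hh
    exact ⟨w, h1, h2, by rw [h3, CoprodI.Word.prod_empty, map_one, mul_one]⟩
  | cons a h k ha hh _ ih =>
    obtain ⟨w, h1, h2, h3⟩ := ih
    obtain ⟨w', h1', h2', h3'⟩ := key w h1 (by simp [h2]) a h ha hh
    exact ⟨w', h1', h2', by rw [h3', h3]⟩

/-- If such an element equals `h`, then either its own nonempty reduced word has value in the base,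
or prepending `h⁻¹` gives a nonempty reduced word of value one. Both contradict the normal form
theorem. -/
theorem StartsInl.notMem_range_inr (hα : Function.Injective α) (hβ : Function.Injective β)
    {k : Amalgam α β} (hk : StartsInl k) : k ∉ (inr α β).range := by
  rintro ⟨h, rfl⟩
  obtain ⟨w, hw, hw1, hwp⟩ := hk.exists_reduced
  by_cases hh : h ∈ β.range
  · have := hw.eq_empty_of_mem_range (amalgamMap_injective hα hβ) (by
      obtain ⟨b, rfl⟩ := hh
      exact ⟨b, by rw [hwp, ← PushoutI.of_apply_eq_base _ false]; rfl⟩)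
    simp [this, CoprodI.Word.fstIdx, CoprodI.Word.empty] at hw1
  · have hh' : h⁻¹ ∉ β.range := fun h' => hh (by simpa using inv_mem h')
    let w' : CoprodI.Word (AmalgamFactor A H) :=
      CoprodI.Word.cons (i := false) (.ofRight h⁻¹) w (by simp [hw1])
        (by intro h1; exact hh' (by rw [show h⁻¹ = 1 from h1]; exact one_mem _))
    have hw' : PushoutI.Reduced (amalgamMap α β) w' := by
      intro g hg
      simp only [w', CoprodI.Word.cons, List.mem_cons] at hg
      rcases hg with rfl | hg
      · exact hh'
      · exact hw g hg
    have := hw'.eq_empty_of_mem_range (amalgamMap_injective hα hβ) (by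
      rw [CoprodI.Word.prod_cons, map_mul, hwp, PushoutI.ofCoprodI_of]
      change inr α β h⁻¹ * inr α β h ∈ _
      rw [← map_mul, inv_mul_cancel, map_one]
      exact one_mem _)
    have h2 := congrArg CoprodI.Word.fstIdx this
    simp [w', CoprodI.Word.fstIdx, CoprodI.Word.empty, CoprodI.Word.cons] at h2

end Amalgam

/-! ### Stars of groups, as pushouts over the centre of the amalgams of each leaf with it -/

/-- The fundamental group of a star of groups: the free product of `H` and copies of `A` indexed
by `ι`, in which `β i b` in `H` is identified with `α b` in the `i`-th copy of `A`. -/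
abbrev StarAmalgam {ι A H : Type u} {B : Type v} [Group A] [Group H] [Group B] (α : B →* A)
    (β : ι → B →* H) : Type (max u v) := PushoutI (fun i => Amalgam.inr α (β i))

namespace StarAmalgam

variable {ι A H : Type u} {B : Type v} [Group A] [Group H] [Group B] (α : B →* A)
  (β : ι → B →* H)

/-- The central group of a star of groups. -/
def center : H →* StarAmalgam α β := PushoutI.base _

/-- The outer groups of a star of groups. -/
def leaf (i : ι) : A →* StarAmalgam α β :=
  (PushoutI.of (φ := fun i => Amalgam.inr α (β i)) i).comp (Amalgam.inl α (β i))

theorem of_inr (i : ι) (h : H) :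
    PushoutI.of (φ := fun i => Amalgam.inr α (β i)) i (Amalgam.inr α (β i) h) = center α β h :=
  PushoutI.of_apply_eq_base _ i h

theorem leaf_apply_eq (i : ι) (b : B) : leaf α β i (α b) = center α β (β i b) := by
  rw [← of_inr α β i, ← Amalgam.inl_comp_eq]
  rfl

variable {α β}

theorem exists_lift {G : Type*} [Group G] (f : H →* G) (g : ι → A →* G)
    (hfg : ∀ i b, g i (α b) = f (β i b)) :
    ∃ F : StarAmalgam α β →* G, (∀ h, F (center α β h) = f h) ∧ ∀ i a, F (leaf α β i a) = g i a := by
  let fac : ∀ i b, AmalgamFactor A H b →* G := fun i b => match b with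
    | true => g i
    | false => f
  have hfac : ∀ i b, (fac i b).comp (amalgamMap α (β i) b) = f.comp (β i) := by
    rintro i (_ | _)
    · rfl
    · ext b
      exact hfg i b
  let F₁ : ∀ i, Amalgam α (β i) →* G := fun i => PushoutI.lift (fac i) _ (hfac i)
  have hF₁ : ∀ i, (F₁ i).comp (Amalgam.inr α (β i)) = f := by
    intro i
    ext h
    exact PushoutI.lift_of (fac i) _ (hfac i) (i := false) h
  refine ⟨PushoutI.lift F₁ f hF₁, fun h => PushoutI.lift_base F₁ f hF₁ h, fun i a => ?_⟩
  exact (PushoutI.lift_of F₁ f hF₁ (i := i) (Amalgam.inl α (β i) a)).trans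
    (PushoutI.lift_of (fac i) _ (hfac i) (i := true) a)

/-- The elements of the group of a star of groups given by reduced words starting in the `i`-th
outer group. -/
inductive StartsLeaf : ι → StarAmalgam α β → Prop
  | last (i : ι) (a : A) (h : H) : a ∉ α.range → StartsLeaf i (leaf α β i a * center α β h)
  | cons (i : ι) (a : A) (h : H) (j : ι) (m : StarAmalgam α β) : a ∉ α.range →
      (i = j → h ∉ (β i).range) → StartsLeaf j m →
      StartsLeaf i (leaf α β i a * center α β h * m)

theorem mul_notMem_range {a : A} (ha : a ∉ α.range) (b : B) : a * α b ∉ α.range := fun h =>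
  ha (by simpa using mul_mem h (inv_mem (⟨b, rfl⟩ : α b ∈ α.range)))

/-- A factor `h` from the edge group is absorbed into `a`, which stays outside `α.range`. -/
theorem exists_startsInl {a : A} (ha : a ∉ α.range) (i : ι) (h : H) :
    ∃ k : Amalgam α (β i), Amalgam.StartsInl k ∧
      leaf α β i a * center α β h = PushoutI.of (φ := fun i => Amalgam.inr α (β i)) i k := by
  by_cases hh : h ∈ (β i).range
  · obtain ⟨b, rfl⟩ := hh
    refine ⟨_, .single _ (mul_notMem_range ha b), ?_⟩
    rw [← leaf_apply_eq, ← map_mul]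
    rfl
  · refine ⟨_, .pair a h ha hh, ?_⟩
    rw [map_mul, of_inr]
    rfl

/-- Consecutive syllables with the same index are collected into one element of `Amalgam α (β i)`.
It lies outside the centre by `Amalgam.StartsInl.notMem_range_inr`, so the collected word is reduced
in the outer pushout. -/
theorem StartsLeaf.exists_reduced (hα : Function.Injective α)
    (hβ : ∀ i, Function.Injective (β i)) {i : ι} {m : StarAmalgam α β} (hm : StartsLeaf i m) :
    ∃ (k : Amalgam α (β i)) (w : CoprodI.Word (fun i => Amalgam α (β i))),
      Amalgam.StartsInl k ∧ PushoutI.Reduced (fun i => Amalgam.inr α (β i)) w ∧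
      w.fstIdx ≠ some i ∧
      m = PushoutI.of (φ := fun i => Amalgam.inr α (β i)) i k * PushoutI.ofCoprodI w.prod := by
  induction hm with
  | last i a h ha =>
    obtain ⟨k, hk, e⟩ := exists_startsInl (β := β) ha i h
    refine ⟨k, .empty, hk, by intro g hg; simp [CoprodI.Word.empty] at hg,
      by simp [CoprodI.Word.fstIdx, CoprodI.Word.empty], ?_⟩
    rw [CoprodI.Word.prod_empty, map_one, mul_one, e]
  | cons i a h j m ha hh _ ih =>
    obtain ⟨k, w, hk, hw, hw1, rfl⟩ := ih
    by_cases hij : i = j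
    · subst hij
      refine ⟨_, w, .cons a h k ha (hh rfl) hk, hw, hw1, ?_⟩
      rw [map_mul, map_mul, of_inr, mul_assoc, mul_assoc, mul_assoc]
      rfl
    · obtain ⟨k', hk', e⟩ := exists_startsInl (β := β) ha i h
      have hkr := hk.notMem_range_inr hα (hβ j)
      refine ⟨k', CoprodI.Word.cons k w hw1 (by rintro rfl; exact hkr (one_mem _)), hk', ?_,
        by simpa using Ne.symm hij, ?_⟩
      · intro g hg
        simp only [CoprodI.Word.cons, List.mem_cons] at hg
        rcases hg with rfl | hg
        · exact hkr
        · exact hw g hg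
      · rw [e, CoprodI.Word.prod_cons, map_mul, PushoutI.ofCoprodI_of]

/-- The normal form theorem for stars of groups. -/
theorem StartsLeaf.notMem_range_center (hα : Function.Injective α)
    (hβ : ∀ i, Function.Injective (β i)) {i : ι} {m : StarAmalgam α β} (hm : StartsLeaf i m) :
    m ∉ (center α β).range := by
  obtain ⟨k, w, hk, hw, hw1, rfl⟩ := hm.exists_reduced hα hβ
  have hkr := hk.notMem_range_inr hα (hβ i)
  let w' : CoprodI.Word (fun i => Amalgam α (β i)) :=
    CoprodI.Word.cons k w hw1 (by rintro rfl; exact hkr (one_mem _))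
  have hw' : PushoutI.Reduced (fun i => Amalgam.inr α (β i)) w' := by
    intro g hg
    simp only [w', CoprodI.Word.cons, List.mem_cons] at hg
    rcases hg with rfl | hg
    · exact hkr
    · exact hw g hg
  intro hmem
  have := hw'.eq_empty_of_mem_range (fun i => Amalgam.inr_injective hα (hβ i)) (by
    rw [CoprodI.Word.prod_cons, map_mul, PushoutI.ofCoprodI_of]
    exact hmem)
  have h2 := congrArg CoprodI.Word.fstIdx this
  simp [w', CoprodI.Word.fstIdx, CoprodI.Word.empty, CoprodI.Word.cons] at h2

theorem center_injective (hα : Function.Injective α) (hβ : ∀ i, Function.Injective (β i)) :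
    Function.Injective (center α β) :=
  PushoutI.base_injective fun i => Amalgam.inr_injective hα (hβ i)

theorem leaf_injective (hα : Function.Injective α) (hβ : ∀ i, Function.Injective (β i)) (i : ι) :
    Function.Injective (leaf α β i) :=
  (PushoutI.of_injective (fun i => Amalgam.inr_injective hα (hβ i)) i).comp
    (Amalgam.inl_injective hα (hβ i))

theorem mem_range_of_leaf_mem (hα : Function.Injective α) (hβ : ∀ i, Function.Injective (β i))
    {i : ι} {a : A} (ha : leaf α β i a ∈ (center α β).range) : a ∈ α.range := by
  by_contra h
  exact (StartsLeaf.last i a 1 h).notMem_range_center hα hβ (by simpa using ha)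

/-- The group of a star of groups is generated by its vertex groups. -/
theorem induction_on {p : StarAmalgam α β → Prop} (hone : p 1)
    (hcenter : ∀ h m, p m → p (center α β h * m)) (hleaf : ∀ i a m, p m → p (leaf α β i a * m))
    (m : StarAmalgam α β) : p m := by
  suffices h : ∀ m n, p n → p (m * n) by simpa using h m 1 hone
  intro m
  induction m using PushoutI.induction_on with
  | of i k =>
    induction k using PushoutI.induction_on with
    | of b a =>
      cases b with
      | true => exact hleaf i a
      | false =>
        intro n hn
        rw [show PushoutI.of i (PushoutI.of false a) = center α β a from of_inr α β i a]
        exact hcenter a n hn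
    | base b =>
      intro n hn
      rw [← PushoutI.of_apply_eq_base _ true]
      exact hleaf i _ n hn
    | mul x y hx hy =>
      intro n hn
      rw [map_mul, mul_assoc]
      exact hx _ (hy _ hn)
  | base h => exact hcenter h
  | mul x y hx hy =>
    intro n hn
    rw [mul_assoc]
    exact hx _ (hy _ hn)

end StarAmalgam

/-! ### Tame groups: transitivity of commutation and unique roots -/

/-- The centralizer of `x` is commutative and `x` has roots of all orders. -/
def HasDivisibleCentralizer {M : Type*} [Group M] (x : M) : Prop :=
  (∀ y z, Commute x y → Commute x z → Commute y z) ∧ ∀ n : ℕ, n ≠ 0 → ∃ z, z ^ n = x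

/-- A torsion-free group in which centralizers of nontrivial elements are cyclic or commutative and
divisible. -/
def IsTameGroup (M : Type*) [Group M] : Prop :=
  ∀ x : M, x ≠ 1 → (∀ n : ℕ, n ≠ 0 → x ^ n ≠ 1) ∧
    (HasCyclicCentralizer x ∨ HasDivisibleCentralizer x)

namespace IsTameGroup

variable {H M : Type*} [Group H] [Group M]

theorem commute_of_commute (hH : IsTameGroup H) {x y z : H} (hx : x ≠ 1) (hy : Commute x y)
    (hz : Commute x z) : Commute y z := by
  rcases (hH x hx).2 with ⟨c, hc⟩ | ⟨h, -⟩
  · obtain ⟨m, rfl⟩ := (hc y).mp hy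
    obtain ⟨n, rfl⟩ := (hc z).mp hz
    exact Commute.zpow_zpow_self c m n
  · exact h y z hy hz

/-- Both `x` and `y` commute with their common power. If it is nontrivial they commute with each
other, so `x * y⁻¹` is torsion. -/
theorem pow_left_injective (hH : IsTameGroup H) {n : ℕ} (hn : n ≠ 0) {x y : H}
    (hxy : x ^ n = y ^ n) : x = y := by
  by_cases h1 : x ^ n = 1
  · have hx : x = 1 := by_contra fun h => (hH x h).1 n hn h1
    have hy : y = 1 := by_contra fun h => (hH y h).1 n hn (hxy ▸ h1)
    rw [hx, hy]
  · have hc : Commute x y := hH.commute_of_commute h1 ((Commute.refl x).pow_left n)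
      (hxy ▸ (Commute.refl y).pow_left n)
    by_contra hne
    refine (hH (x * y⁻¹) (by rwa [Ne, mul_inv_eq_one])).1 n hn ?_
    rw [hc.inv_right.mul_pow, inv_pow, hxy, mul_inv_cancel]

/-- This transfers tameness from a vertex group to elements whose centralizer lies in a vertex
stabilizer. -/
theorem map_of_injective (hH : IsTameGroup H) (f : H →* M) (hf : Function.Injective f) {x : M}
    (hx : x ≠ 1) (hxf : ∀ y, Commute x y → y ∈ f.range) :
    (∀ n : ℕ, n ≠ 0 → x ^ n ≠ 1) ∧ (HasCyclicCentralizer x ∨ HasDivisibleCentralizer x) := by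
  obtain ⟨h, rfl⟩ := hxf x (Commute.refl x)
  have hcomm : ∀ {a b : H}, Commute (f a) (f b) ↔ Commute a b := by
    intro a b
    refine ⟨fun hab => hf ?_, fun hab => hab.map f⟩
    rw [map_mul, map_mul, hab.eq]
  obtain ⟨htf, hc⟩ := hH h (by rintro rfl; exact hx (map_one f))
  refine ⟨fun n hn h1 => htf n hn (hf (by rw [map_pow, h1, map_one])), ?_⟩
  rcases hc with ⟨c, hc⟩ | ⟨hc, hr⟩
  · refine Or.inl ⟨f c, fun y => ⟨fun hy => ?_, ?_⟩⟩
    · obtain ⟨k, rfl⟩ := hxf y hy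
      obtain ⟨n, rfl⟩ := (hc k).mp (hcomm.mp hy)
      exact ⟨n, (map_zpow f c n).symm⟩
    · rintro ⟨n, rfl⟩
      exact (hcomm.mpr ((hc c).mpr (Subgroup.mem_zpowers c))).zpow_right n
  · refine Or.inr ⟨fun y z hy hz => ?_, fun n hn => ?_⟩
    · obtain ⟨k, rfl⟩ := hxf y hy
      obtain ⟨l, rfl⟩ := hxf z hz
      exact hcomm.mpr (hc k l (hcomm.mp hy) (hcomm.mp hz))
    · obtain ⟨z, rfl⟩ := hr n hn
      exact ⟨f z, (map_pow f z n).symm⟩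

end IsTameGroup

/-! ### The Bass-Serre tree of a star of groups -/

namespace StarAmalgam

variable {ι A H : Type u} {B : Type v} [Group A] [Group H] [Group B] (α : B →* A)
  (β : ι → B →* H)

/-- The vertices of the Bass-Serre tree of a star of groups. -/
abbrev Vertex : Type (max u v) :=
  (StarAmalgam α β ⧸ (center α β).range) ⊕ (Σ i, StarAmalgam α β ⧸ (leaf α β i).range)

variable {α β}

/-- The vertex given by a coset of the central group. -/
def blackVertex (g : StarAmalgam α β) : Vertex α β := Sum.inl (g : _ ⧸ (center α β).range)

/-- The vertex given by a coset of an outer group. -/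
def whiteVertex (g : StarAmalgam α β) (i : ι) : Vertex α β :=
  Sum.inr ⟨i, (g : _ ⧸ (leaf α β i).range)⟩

theorem smul_blackVertex (m g : StarAmalgam α β) : m • blackVertex g = blackVertex (m * g) := rfl

theorem smul_whiteVertex (m g : StarAmalgam α β) (i : ι) :
    m • whiteVertex g i = whiteVertex (m * g) i := rfl

theorem blackVertex_eq_iff {g g' : StarAmalgam α β} :
    blackVertex g = blackVertex g' ↔ ∃ h, g' = g * center α β h := by
  rw [blackVertex, blackVertex, Sum.inl.injEq, QuotientGroup.eq]
  exact ⟨fun ⟨h, e⟩ => ⟨h, by rw [e, mul_inv_cancel_left]⟩,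
    fun ⟨h, e⟩ => ⟨h, by rw [e, inv_mul_cancel_left]⟩⟩

theorem whiteVertex_eq_iff {g g' : StarAmalgam α β} {i : ι} :
    whiteVertex g i = whiteVertex g' i ↔ ∃ a, g' = g * leaf α β i a := by
  rw [whiteVertex, whiteVertex, Sum.inr.injEq, Sigma.mk.injEq, heq_eq_eq, QuotientGroup.eq]
  exact ⟨fun ⟨_, a, e⟩ => ⟨a, by rw [e, mul_inv_cancel_left]⟩,
    fun ⟨a, e⟩ => ⟨rfl, a, by rw [e, inv_mul_cancel_left]⟩⟩

theorem whiteVertex_index {g g' : StarAmalgam α β} {i j : ι}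
    (h : whiteVertex g i = whiteVertex g' j) : i = j := by
  rw [whiteVertex, whiteVertex, Sum.inr.injEq, Sigma.mk.injEq] at h
  exact h.1

theorem blackVertex_ne_whiteVertex {g g' : StarAmalgam α β} {i : ι} :
    blackVertex g ≠ whiteVertex g' i := Sum.inl_ne_inr

theorem exists_eq_vertex (v : Vertex α β) :
    (∃ g, v = blackVertex g) ∨ ∃ g i, v = whiteVertex g i := by
  rcases v with b | ⟨i, w⟩
  · obtain ⟨g, rfl⟩ := QuotientGroup.mk_surjective b
    exact Or.inl ⟨g, rfl⟩
  · obtain ⟨g, rfl⟩ := QuotientGroup.mk_surjective w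
    exact Or.inr ⟨g, i, rfl⟩

variable (α β)

/-- The Bass-Serre tree of a star of groups. -/
def tree : SimpleGraph (Vertex α β) where
  Adj u v := ∃ g i, (u = blackVertex g ∧ v = whiteVertex g i) ∨
    (u = whiteVertex g i ∧ v = blackVertex g)
  symm := ⟨fun _ _ ⟨g, i, h⟩ => ⟨g, i, h.symm.imp And.symm And.symm⟩⟩
  loopless := ⟨by
    rintro v ⟨g, i, ⟨rfl, h⟩ | ⟨rfl, h⟩⟩
    · exact blackVertex_ne_whiteVertex h
    · exact blackVertex_ne_whiteVertex h.symm⟩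

variable {α β}

theorem tree_adj (g : StarAmalgam α β) (i : ι) :
    (tree α β).Adj (blackVertex g) (whiteVertex g i) := ⟨g, i, Or.inl ⟨rfl, rfl⟩⟩

theorem tree_adj_blackVertex {g : StarAmalgam α β} {v : Vertex α β}
    (h : (tree α β).Adj (blackVertex g) v) : ∃ h i, v = whiteVertex (g * center α β h) i := by
  obtain ⟨g', i, ⟨e, rfl⟩ | ⟨e, -⟩⟩ := h
  · obtain ⟨h, rfl⟩ := blackVertex_eq_iff.mp e
    exact ⟨h, i, rfl⟩
  · exact absurd e blackVertex_ne_whiteVertex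

theorem tree_adj_whiteVertex {g : StarAmalgam α β} {i : ι} {v : Vertex α β}
    (h : (tree α β).Adj (whiteVertex g i) v) : ∃ a, v = blackVertex (g * leaf α β i a) := by
  obtain ⟨g', j, ⟨e, -⟩ | ⟨e, rfl⟩⟩ := h
  · exact absurd e.symm blackVertex_ne_whiteVertex
  · obtain rfl := whiteVertex_index e
    obtain ⟨a, rfl⟩ := whiteVertex_eq_iff.mp e
    exact ⟨a, rfl⟩

theorem tree_adj_smul (m : StarAmalgam α β) (u v : Vertex α β) (h : (tree α β).Adj u v) :
    (tree α β).Adj (m • u) (m • v) := by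
  obtain ⟨g, i, ⟨rfl, rfl⟩ | ⟨rfl, rfl⟩⟩ := h
  · exact tree_adj (m * g) i
  · exact (tree_adj (m * g) i).symm

theorem tree_reachable_smul (m : StarAmalgam α β) {u v : Vertex α β}
    (h : (tree α β).Reachable u v) : (tree α β).Reachable (m • u) (m • v) :=
  h.map (⟨fun v => m • v, fun {a b} h => tree_adj_smul m a b h⟩ : tree α β →g tree α β)

theorem tree_connected : (tree α β).Connected := by
  have hb : ∀ g, (tree α β).Reachable (blackVertex 1) (blackVertex g) := by
    intro g
    induction g using induction_on with
    | hone => exact .refl _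
    | hcenter h m hm =>
      have := tree_reachable_smul (center α β h) hm
      rw [smul_blackVertex, smul_blackVertex] at this
      have e : blackVertex (α := α) (β := β) 1 = blackVertex (center α β h * 1) :=
        blackVertex_eq_iff.mpr ⟨h, by rw [mul_one, one_mul]⟩
      rwa [e]
    | hleaf i a m hm =>
      have := tree_reachable_smul (leaf α β i a) hm
      rw [smul_blackVertex, smul_blackVertex, mul_one] at this
      refine SimpleGraph.Reachable.trans ?_ this
      refine (tree_adj 1 i).reachable.trans ?_
      rw [whiteVertex_eq_iff.mpr ⟨a, (one_mul _).symm⟩]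
      exact (tree_adj _ i).symm.reachable
  have hall : ∀ v, (tree α β).Reachable (blackVertex 1) v := by
    intro v
    rcases exists_eq_vertex v with ⟨g, rfl⟩ | ⟨g, i, rfl⟩
    · exact hb g
    · exact (hb g).trans (tree_adj g i).reachable
  exact SimpleGraph.connected_iff_exists_forall_reachable _ |>.mpr ⟨_, hall⟩

/-- A trail between black vertices spells out a reduced word. -/
theorem exists_startsLeaf_of_isTrail (n : ℕ) : ∀ {u v : Vertex α β} (p : (tree α β).Walk u v)
    (g g' : StarAmalgam α β), p.length ≤ n → 0 < p.length → p.IsTrail → u = blackVertex g →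
    v = blackVertex g' → ∃ i h m, StartsLeaf i m ∧ g' = g * center α β h * m ∧
      p.snd = whiteVertex (g * center α β h) i := by
  induction n with
  | zero => intro u v p g g' h1 h2; omega
  | succ n ih =>
    rintro u v p g g' hn h0 hp rfl hv
    cases p with
    | nil => simp at h0
    | @cons _ w _ hw p₁ =>
      obtain ⟨h, i, rfl⟩ := tree_adj_blackVertex hw
      cases p₁ with
      | nil => exact absurd hv.symm blackVertex_ne_whiteVertex
      | @cons _ b _ hb q =>
        obtain ⟨a, rfl⟩ := tree_adj_whiteVertex hb
        rw [SimpleGraph.Walk.isTrail_cons, SimpleGraph.Walk.isTrail_cons] at hp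
        obtain ⟨⟨hq, hbq⟩, hwq⟩ := hp
        -- Otherwise the trail would return along the edge by which it reached the white vertex.
        have ha : a ∉ α.range := by
          rintro ⟨b, rfl⟩
          refine hwq ?_
          rw [SimpleGraph.Walk.edges_cons, List.mem_cons]
          left
          rw [Sym2.eq_swap, leaf_apply_eq, mul_assoc, ← map_mul,
            ← blackVertex_eq_iff.mpr ⟨_, rfl⟩]
        by_cases hq0 : q.length = 0
        · have e := SimpleGraph.Walk.eq_of_length_eq_zero hq0
          obtain ⟨h', e'⟩ := blackVertex_eq_iff.mp (e.trans hv)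
          exact ⟨i, h, _, .last i a h' ha, by rw [e']; simp only [mul_assoc], by simp⟩
        · obtain ⟨j, h', m, hm, e, hs⟩ := ih q (g * center α β h * leaf α β i a) g'
            (by simp only [SimpleGraph.Walk.length_cons] at hn; omega)
            (Nat.pos_of_ne_zero hq0) hq rfl hv
          refine ⟨i, h, _, .cons i a h' j m ha ?_ hm, by rw [e]; simp only [mul_assoc], by simp⟩
          -- Here the next white vertex would be the one just left, again repeating an edge.
          rintro rfl ⟨b, rfl⟩
          cases q with
          | nil => simp at hq0
          | @cons _ w _ hw' q =>
            rw [SimpleGraph.Walk.snd_cons] at hs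
            subst hs
            refine hbq ?_
            rw [SimpleGraph.Walk.edges_cons, List.mem_cons]
            left
            rw [Sym2.eq_swap, ← leaf_apply_eq, mul_assoc (g * _), ← map_mul,
              ← whiteVertex_eq_iff.mpr ⟨_, rfl⟩]

/-- A cycle based at a black vertex would spell a reduced word lying in the centre, against the
normal form theorem. A cycle based at a white vertex can be rotated to a black one. -/
theorem tree_isTree (hα : Function.Injective α) (hβ : ∀ i, Function.Injective (β i)) :
    (tree α β).IsTree := by
  classical
  have hb : ∀ (g : StarAmalgam α β) (c : (tree α β).Walk (blackVertex g) (blackVertex g)),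
      ¬ c.IsCycle := by
    intro g c hc
    have h3 := hc.three_le_length
    obtain ⟨i, h, m, hm, e, -⟩ :=
      exists_startsLeaf_of_isTrail _ c g g le_rfl (by omega) hc.isTrail rfl rfl
    refine hm.notMem_range_center hα hβ ⟨h⁻¹, ?_⟩
    rw [mul_assoc, left_eq_mul] at e
    rw [map_inv, inv_eq_of_mul_eq_one_right e]
  refine ⟨tree_connected, ?_⟩
  intro v c hc
  rcases exists_eq_vertex v with ⟨g, rfl⟩ | ⟨g, i, rfl⟩
  · exact hb g c hc
  · cases c with
    | nil => exact hc.ne_nil rfl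
    | @cons _ b _ h p =>
      obtain ⟨a, rfl⟩ := tree_adj_whiteVertex h
      exact hb _ _ (hc.rotate (u := blackVertex (g * leaf α β i a)) (by simp))

/-- The fundamental group of a star of tame groups with malnormal edge groups is tame. -/
theorem isTameGroup (hα : Function.Injective α) (hβ : ∀ i, Function.Injective (β i))
    (hmal : ∀ i j h b b', b ≠ 1 → h * β i b * h⁻¹ = β j b' → i = j ∧ h ∈ (β i).range)
    (hA : IsTameGroup A) (hH : IsTameGroup H) : IsTameGroup (StarAmalgam α β) := by
  intro x hx
  have hcenter := center_injective hα hβ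
  have hfixb : ∀ {y g : StarAmalgam α β}, y • blackVertex g = blackVertex g →
      ∃ h, y = g * center α β h * g⁻¹ := by
    intro y g h
    obtain ⟨h, e⟩ := blackVertex_eq_iff.mp (h.symm.trans (smul_blackVertex y g))
    exact ⟨h, by rw [← e, mul_inv_cancel_right]⟩
  have hfixw : ∀ {y g : StarAmalgam α β} {i : ι}, y • whiteVertex g i = whiteVertex g i →
      ∃ a, y = g * leaf α β i a * g⁻¹ := by
    intro y g i h
    obtain ⟨a, e⟩ := whiteVertex_eq_iff.mp (h.symm.trans (smul_whiteVertex y g i))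
    exact ⟨a, by rw [← e, mul_inv_cancel_right]⟩
  have hcol : ∀ u v, (tree α β).Adj u v → (u.isLeft ↔ ¬ v.isLeft) := by
    rintro u v ⟨g, i, ⟨rfl, rfl⟩ | ⟨rfl, rfl⟩⟩ <;> simp [blackVertex, whiteVertex]
  have hblack : ∀ (g : StarAmalgam α β) (v : Vertex α β), (g • v).isLeft ↔ v.isLeft := by
    rintro g (a | a) <;> rfl
  have hedge : ∀ (y : StarAmalgam α β) (b w w' : Vertex α β), b.isLeft → (tree α β).Adj b w →
      (tree α β).Adj b w' → w ≠ w' → y • b = b → y • w = w → y • w' = w' → y = 1 := by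
    intro y b w w' hb hw hw' hne hyb hyw hyw'
    rcases exists_eq_vertex b with ⟨g, rfl⟩ | ⟨g, i, rfl⟩
    · obtain ⟨h, i, rfl⟩ := tree_adj_blackVertex hw
      obtain ⟨h', j, rfl⟩ := tree_adj_blackVertex hw'
      obtain ⟨k, rfl⟩ := hfixb hyb
      have key : ∀ {h : H} {i : ι}, (g * center α β k * g⁻¹) • whiteVertex (g * center α β h) i =
          whiteVertex (g * center α β h) i → ∃ b, k = h * β i b * h⁻¹ := by
        intro h i e
        obtain ⟨a, ea⟩ := hfixw e
        have e1 : leaf α β i a = center α β (h⁻¹ * k * h) := by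
          have : leaf α β i a = (g * center α β h)⁻¹ *
              (g * center α β h * leaf α β i a * (g * center α β h)⁻¹) * (g * center α β h) := by
            group
          rw [this, ← ea]
          simp only [map_mul, map_inv]
          group
        obtain ⟨b, rfl⟩ := mem_range_of_leaf_mem hα hβ ⟨_, e1.symm⟩
        rw [leaf_apply_eq] at e1
        refine ⟨b, ?_⟩
        rw [hcenter e1]
        group
      obtain ⟨b, eb⟩ := key hyw
      obtain ⟨b', eb'⟩ := key hyw'
      by_cases hb1 : b = 1
      · rw [eb, hb1]
        simp
      -- The element `k` is conjugate into both edge groups, so malnormality identifies the two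
      -- edges.
      · obtain ⟨rfl, c, hc⟩ := hmal i j (h'⁻¹ * h) b b' hb1 (by
          have : β j b' = h'⁻¹ * k * h' := by rw [eb']; group
          rw [this, eb]
          group)
        refine absurd (whiteVertex_eq_iff.mpr ⟨α c⁻¹, ?_⟩) hne
        rw [leaf_apply_eq, mul_assoc, ← map_mul, map_inv, hc]
        congr 2
        group
    · exact absurd hb (by simp [whiteVertex])
  rcases (tree_isTree hα hβ).centralizer_trichotomy tree_adj_smul
    hcol hblack hedge hx with ⟨w, hw, hxw⟩ | ⟨b, hb, hxb⟩ | ⟨h1, h2⟩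
  · rcases exists_eq_vertex w with ⟨g, rfl⟩ | ⟨g, i, rfl⟩
    · exact absurd rfl hw
    · refine hA.map_of_injective ((MulAut.conj g).toMonoidHom.comp (leaf α β i))
        ((MulAut.conj g).injective.comp (leaf_injective hα hβ i)) hx fun y hy => ?_
      obtain ⟨a, rfl⟩ := hfixw (hxw y hy)
      exact ⟨a, rfl⟩
  · rcases exists_eq_vertex b with ⟨g, rfl⟩ | ⟨g, i, rfl⟩
    · refine hH.map_of_injective ((MulAut.conj g).toMonoidHom.comp (center α β))
        ((MulAut.conj g).injective.comp hcenter) hx fun y hy => ?_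
      obtain ⟨a, rfl⟩ := hfixb (hxb y hy)
      exact ⟨a, rfl⟩
    · exact absurd hb (by simp [whiteVertex])
  · exact ⟨h2, Or.inl h1⟩

end StarAmalgam

/-! ### Divisible groups receive homomorphisms from `ℚ` -/

theorem IsDivisibleGroup.exists_pow_eq {G : Type u} [Group G] (hG : IsDivisibleGroup G) (n : ℕ)
    (hn : n ≠ 0) (g : G) : ∃ z, z ^ n = g := by
  obtain ⟨z, hz⟩ := hG n (by exact_mod_cast hn) g
  exact ⟨z, by simpa using hz⟩

/-- Every element of a divisible group is the value at `1` of a homomorphism from `ℚ`. -/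
theorem IsDivisibleGroup.exists_hom_rat {G : Type u} [Group G] (hG : IsDivisibleGroup G) (g : G) :
    ∃ f : Multiplicative ℚ →* G, f (Multiplicative.ofAdd 1) = g := by
  choose r hr using fun n : ℕ => hG.exists_pow_eq (n + 1) n.succ_ne_zero
  -- Successive roots make `s n` an `n!`-th root of `g`, so `z / n!` can be sent to `s n ^ z`.
  let s : ℕ → G := fun n => Nat.rec g (fun n x => r n x) n
  have hs : ∀ n, s (n + 1) ^ (n + 1) = s n := fun n => hr n (s n)
  have hup : ∀ (q : ℚ) (n : ℕ) (z : ℤ), q * n.factorial = z → ∀ N, n ≤ N →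
      ∃ z' : ℤ, q * N.factorial = z' ∧ s n ^ z = s N ^ z' := by
    intro q n z hz N hN
    induction N, hN using Nat.le_induction with
    | base => exact ⟨z, hz, rfl⟩
    | succ N _ ih =>
      obtain ⟨z', h1, h2⟩ := ih
      refine ⟨(N + 1 : ℕ) * z', ?_, ?_⟩
      · rw [Nat.factorial_succ]
        push_cast
        rw [← h1]
        ring
      · rw [h2, zpow_mul, zpow_natCast, hs]
  have hex : ∀ q : ℚ, ∃ x, ∃ (n : ℕ) (z : ℤ), q * n.factorial = z ∧ x = s n ^ z := by
    intro q
    refine ⟨_, q.den, q.num * (q.den - 1).factorial, ?_, rfl⟩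
    have h1 := Nat.mul_factorial_pred q.den_ne_zero
    rw [← h1]
    push_cast
    rw [← mul_assoc, Rat.mul_den_eq_num]
  choose f n z hz hf using hex
  have hfN : ∀ (q : ℚ) (N : ℕ) (w : ℤ), q * N.factorial = w → f q = s N ^ w := by
    intro q N w hw
    obtain ⟨z₁, h1, h1'⟩ := hup q (n q) (z q) (hz q) (max (n q) N) (le_max_left _ _)
    obtain ⟨z₂, h2, h2'⟩ := hup q N w hw (max (n q) N) (le_max_right _ _)
    have : z₁ = z₂ := by exact_mod_cast h1.symm.trans h2
    rw [hf, h1', h2', this]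
  refine ⟨MonoidHom.mk' (fun q => f q.toAdd) ?_, ?_⟩
  · intro a b
    obtain ⟨z₁, h1, -⟩ := hup a.toAdd _ _ (hz _) (max (n a.toAdd) (n b.toAdd)) (le_max_left _ _)
    obtain ⟨z₂, h2, -⟩ := hup b.toAdd _ _ (hz _) (max (n a.toAdd) (n b.toAdd)) (le_max_right _ _)
    rw [hfN _ _ _ h1, hfN _ _ _ h2, ← zpow_add]
    refine hfN _ _ _ ?_
    rw [toAdd_mul, add_mul, h1, h2]
    push_cast
    rfl
  · change f 1 = g
    rw [hfN 1 0 1 (by simp), zpow_one]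
    rfl

/-- A multiplicative copy of `ℚ` in the universe `u`. -/
abbrev RatGroup : Type u := ULift.{u} (Multiplicative ℚ)

theorem RatGroup.pow_eq_iff (a b : RatGroup.{u}) (n : ℕ) :
    a ^ n = b ↔ (n : ℚ) * a.down.toAdd = b.down.toAdd := by
  rw [← ULift.down_inj, ULift.pow_down, ← Multiplicative.toAdd.injective.eq_iff, toAdd_pow,
    nsmul_eq_mul]

theorem RatGroup.exists_pow_eq (n : ℕ) (hn : n ≠ 0) (a : RatGroup.{u}) : ∃ z, z ^ n = a := by
  refine ⟨⟨Multiplicative.ofAdd (a.down.toAdd / n)⟩, (pow_eq_iff _ _ _).mpr ?_⟩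
  have : (n : ℚ) ≠ 0 := by exact_mod_cast hn
  rw [toAdd_ofAdd]
  field_simp

theorem RatGroup.isTameGroup : IsTameGroup RatGroup.{u} := by
  refine fun x hx => ⟨fun n hn h => hx ?_, Or.inr ⟨fun y z _ _ => Commute.all y z,
    fun n hn => exists_pow_eq n hn x⟩⟩
  rw [pow_eq_iff] at h
  have hn' : (n : ℚ) ≠ 0 := by exact_mod_cast hn
  exact ULift.down_injective (Multiplicative.toAdd.injective
    ((mul_eq_zero.mp (h.trans rfl)).resolve_left hn'))

/-- The inclusion of `ℤ` in `ℚ`, written multiplicatively. -/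
def RatGroup.ofInt : Multiplicative ℤ →* RatGroup.{u} :=
  MulEquiv.ulift.symm.toMonoidHom.comp (AddMonoidHom.toMultiplicative (Int.castAddHom ℚ))

theorem RatGroup.ofInt_injective : Function.Injective RatGroup.ofInt.{u} := fun _ _ h =>
  Multiplicative.toAdd.injective (Int.cast_injective (α := ℚ) (congrArg (fun x => x.down.toAdd) h))

theorem IsDivisibleGroup.exists_hom_ratGroup {G : Type v} [Group G] (hG : IsDivisibleGroup G)
    (g : G) : ∃ f : RatGroup.{u} →* G, f (RatGroup.ofInt (Multiplicative.ofAdd 1)) = g := by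
  obtain ⟨f, hf⟩ := hG.exists_hom_rat g
  refine ⟨f.comp MulEquiv.ulift.toMonoidHom, ?_⟩
  rw [← hf]
  change f (Multiplicative.ofAdd ((1 : ℤ) : ℚ)) = _
  rw [Int.cast_one]

/-! ### Adjoining roots to a tame group -/

namespace IsTameGroup

variable {H : Type u} [Group H]

theorem zpow_ne_one (hH : IsTameGroup H) {x : H} (hx : x ≠ 1) {k : ℤ} (hk : k ≠ 0) :
    x ^ k ≠ 1 := by
  intro h
  refine (hH x hx).1 k.natAbs (by simpa using hk) ?_
  rcases Int.natAbs_eq k with e | e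
  · rwa [e, zpow_natCast] at h
  · rwa [e, zpow_neg, zpow_natCast, inv_eq_one] at h

/-- In a tame group no element is conjugate to its inverse. -/
theorem conj_ne_inv (hH : IsTameGroup H) {c : H} (hc : c ≠ 1) (h : H) : h * c * h⁻¹ ≠ c⁻¹ := by
  intro e
  have h1 : h * c = c⁻¹ * h := by rw [← e]; group
  have h2 : h * c⁻¹ = c * h := by
    have : h * c⁻¹ * h⁻¹ = c := by
      rw [show h * c⁻¹ * h⁻¹ = (h * c * h⁻¹)⁻¹ by group, e, inv_inv]
    rw [← mul_inv_eq_iff_eq_mul, this]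
  have hne : h ≠ 1 := by
    rintro rfl
    refine (hH c hc).1 2 two_ne_zero ?_
    rwa [one_mul, inv_one, mul_one, eq_inv_iff_mul_eq_one, ← pow_two] at e
  -- Inverting twice is trivial; transitivity then makes `h` commute with `c`, forcing `c ^ 2 = 1`.
  have hcomm : Commute (h ^ 2) c := by
    rw [Commute, SemiconjBy, pow_two, mul_assoc, h1, ← mul_assoc, h2, mul_assoc]
  have hhc : Commute h c :=
    hH.commute_of_commute ((hH h hne).1 2 two_ne_zero) ((Commute.refl h).pow_left 2) hcomm
  rw [hhc.eq, mul_inv_cancel_right, eq_inv_iff_mul_eq_one, ← pow_two] at e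
  exact (hH c hc).1 2 two_ne_zero e

/-- The nontrivial elements generating their own centralizer. -/
def SelfCentralizing (H : Type u) [Group H] : Type u :=
  {c : H // c ≠ 1 ∧ ∀ y, Commute c y ↔ y ∈ Subgroup.zpowers c}

/-- Conjugacy up to inversion. -/
def conjSetoid (H : Type u) [Group H] : Setoid (SelfCentralizing H) where
  r c d := ∃ h : H, h * c.1 * h⁻¹ = d.1 ∨ h * c.1 * h⁻¹ = d.1⁻¹
  iseqv := by
    refine ⟨fun c => ⟨1, Or.inl (by group)⟩, ?_, ?_⟩
    · rintro c d ⟨h, e | e⟩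
      · exact ⟨h⁻¹, Or.inl (by rw [← e]; group)⟩
      · exact ⟨h⁻¹, Or.inr (by rw [eq_inv_iff_mul_eq_one, ← inv_inv d.1, ← e]; group)⟩
    · rintro c d f ⟨h, e⟩ ⟨k, e'⟩
      have hk : ∀ x : H, k * h * x * (k * h)⁻¹ = k * (h * x * h⁻¹) * k⁻¹ := fun x => by group
      refine ⟨k * h, ?_⟩
      rw [hk]
      rcases e with e | e
      · rw [e]
        exact e'
      · have : k * d.1⁻¹ * k⁻¹ = (k * d.1 * k⁻¹)⁻¹ := by group
        rw [e, this]
        rcases e' with e' | e'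
        · exact Or.inr (by rw [e'])
        · exact Or.inl (by rw [e', inv_inv])

/-- Sharing a nontrivial power, the conjugate of `c` and `d` commute. Each generates its own
centralizer, so each is a power of the other, and torsion-freeness leaves only the exponents `1` and
`-1`. -/
theorem eq_or_eq_inv_of_conj (hH : IsTameGroup H) (c d : SelfCentralizing H) {h : H} {m n : ℤ}
    (hm : m ≠ 0) (e : h * c.1 ^ m * h⁻¹ = d.1 ^ n) :
    h * c.1 * h⁻¹ = d.1 ∨ h * c.1 * h⁻¹ = d.1⁻¹ := by
  have hne : h * c.1 * h⁻¹ ≠ 1 := by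
    rw [Ne, conj_eq_one_iff]
    exact c.2.1
  rw [← conj_zpow] at e
  have hcomm : Commute (h * c.1 * h⁻¹) d.1 :=
    hH.commute_of_commute (hH.zpow_ne_one hne hm) ((Commute.refl _).zpow_left m)
      (e ▸ (Commute.refl _).zpow_left n)
  obtain ⟨k, hk⟩ := (d.2.2 _).mp hcomm.symm
  have hcomm' : Commute c.1 (h⁻¹ * d.1 * h) := by
    have := hcomm.eq
    rw [Commute, SemiconjBy]
    calc c.1 * (h⁻¹ * d.1 * h) = h⁻¹ * ((h * c.1 * h⁻¹) * d.1) * h := by group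
      _ = h⁻¹ * (d.1 * (h * c.1 * h⁻¹)) * h := by rw [this]
      _ = _ := by group
  obtain ⟨l, hl⟩ := (c.2.2 _).mp hcomm'
  have hd : d.1 = (h * c.1 * h⁻¹) ^ l := by
    rw [conj_zpow]
    simp only at hl
    rw [hl]
    group
  simp only at hk
  have hlk : l * k = 1 := by
    by_contra hne'
    refine hH.zpow_ne_one hne (sub_ne_zero.mpr hne') ?_
    rw [zpow_sub, zpow_mul, ← hd, hk, zpow_one, mul_inv_cancel]
  rcases Int.eq_one_or_neg_one_of_mul_eq_one' hlk with ⟨-, rfl⟩ | ⟨-, rfl⟩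
  · exact Or.inl (by rw [← hk, zpow_one])
  · exact Or.inr (by rw [← hk, zpow_neg_one])

/-- A tame group over a divisible group maps to a tame group in which its elements have roots. -/
theorem exists_adjoin_roots (hH : IsTameGroup H) {G : Type v} [Group G] (hG : IsDivisibleGroup G)
    (π : H →* G) : ∃ (M : Type u) (_ : Group M) (_ : IsTameGroup M) (f : H →* M) (p : M →* G),
      p.comp f = π ∧ ∀ (n : ℕ) (h : H), n ≠ 0 → ∃ z, z ^ n = f h := by
  let c : Quotient (conjSetoid H) → SelfCentralizing H := fun i => Quotient.out i
  let β : Quotient (conjSetoid H) → Multiplicative ℤ →* H := fun i => zpowersHom H (c i).1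
  have hβ' : ∀ i b, β i b = (c i).1 ^ b.toAdd := fun i b => zpowersHom_apply H _ b
  have hβ : ∀ i, Function.Injective (β i) := by
    intro i
    rw [injective_iff_map_eq_one]
    intro b hb
    by_contra hne
    rw [hβ'] at hb
    exact hH.zpow_ne_one (c i).2.1 (fun h => hne (Multiplicative.toAdd.injective h)) hb
  have hmal : ∀ i j h b b', b ≠ 1 → h * β i b * h⁻¹ = β j b' → i = j ∧ h ∈ (β i).range := by
    intro i j h b b' hb e
    rw [hβ', hβ'] at e
    have hb' : b.toAdd ≠ 0 := fun h => hb (Multiplicative.toAdd.injective h)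
    have key := hH.eq_or_eq_inv_of_conj (c i) (c j) hb' e
    obtain rfl : i = j := Quotient.out_equiv_out.mp ⟨h, key⟩
    refine ⟨rfl, ?_⟩
    have hcomm : Commute (c i).1 h := by
      rcases key with e | e
      · exact (mul_inv_eq_iff_eq_mul.mp e).symm
      -- Excluding inversion is what puts `h` in the centralizer, and so in the edge group.
      · exact absurd e (hH.conj_ne_inv (c i).2.1 h)
    obtain ⟨k, hk⟩ := ((c i).2.2 h).mp hcomm
    exact ⟨Multiplicative.ofAdd k, by rw [hβ']; exact hk⟩
  choose ρ hρ using fun i => hG.exists_hom_ratGroup.{u} (π (c i).1)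
  have hcompat : ∀ i b, ρ i (RatGroup.ofInt b) = π (β i b) := by
    intro i b
    have : (ρ i).comp RatGroup.ofInt = π.comp (β i) := by
      refine MonoidHom.ext_mint ?_
      rw [MonoidHom.comp_apply, hρ, MonoidHom.comp_apply, hβ', toAdd_ofAdd, zpow_one]
    exact DFunLike.congr_fun this b
  obtain ⟨p, hp, -⟩ := StarAmalgam.exists_lift π ρ hcompat
  refine ⟨StarAmalgam RatGroup.ofInt β, inferInstance,
    StarAmalgam.isTameGroup RatGroup.ofInt_injective hβ hmal RatGroup.isTameGroup hH,
    StarAmalgam.center _ β, p, MonoidHom.ext hp, fun n h hn => ?_⟩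
  by_cases h1 : h = 1
  · exact ⟨1, by rw [h1, one_pow, map_one]⟩
  rcases (hH h h1).2 with ⟨d, hd⟩ | ⟨-, hr⟩
  · obtain ⟨m, hm⟩ := (hd h).mp (Commute.refl h)
    simp only at hm
    have hd1 : d ≠ 1 := by
      rintro rfl
      rw [one_zpow] at hm
      exact h1 hm.symm
    -- Whatever commutes with `d` commutes with its power `h`, so the generator of the centralizer
    -- of `h` is self-centralizing.
    let d' : SelfCentralizing H := ⟨d, hd1, fun y => ⟨fun hy => (hd y).mp (by
      rw [← hm]
      exact hy.zpow_left m), by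
      rintro ⟨k, rfl⟩
      exact (Commute.refl d).zpow_right k⟩⟩
    obtain ⟨g, hg⟩ : ∃ g : H, g * (c ⟦d'⟧).1 * g⁻¹ = d ∨ g * (c ⟦d'⟧).1 * g⁻¹ = d⁻¹ :=
      Quotient.mk_out (s := conjSetoid H) d'
    obtain ⟨b, hb⟩ : ∃ b, g * β ⟦d'⟧ b * g⁻¹ = h := by
      rcases hg with hg | hg
      · exact ⟨Multiplicative.ofAdd m, by rw [hβ', toAdd_ofAdd, ← conj_zpow, hg, hm]⟩
      · exact ⟨Multiplicative.ofAdd (-m), by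
          rw [hβ', toAdd_ofAdd, ← conj_zpow, hg, inv_zpow, zpow_neg, inv_inv, hm]⟩
    obtain ⟨a, ha⟩ := RatGroup.exists_pow_eq n hn (RatGroup.ofInt b)
    refine ⟨StarAmalgam.center _ β g * StarAmalgam.leaf _ β ⟦d'⟧ a *
      (StarAmalgam.center _ β g)⁻¹, ?_⟩
    rw [conj_pow, ← map_pow, ha, StarAmalgam.leaf_apply_eq, ← hb, map_mul, map_mul, map_inv]
  · obtain ⟨z, rfl⟩ := hr n hn
    exact ⟨StarAmalgam.center _ β z, (map_pow _ _ _).symm⟩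

end IsTameGroup

/-- Every map from a set to a divisible group factors through a tame group. -/
theorem IsDivisibleGroup.exists_isTameGroup {G : Type v} [Group G] (hG : IsDivisibleGroup G)
    {X : Type u} (φ : X → G) : ∃ (M : Type u) (_ : Group M) (_ : IsTameGroup M) (p : M →* G)
      (s : X → M), ∀ x, p (s x) = φ x := by
  choose ρ hρ using fun x => hG.exists_hom_ratGroup.{u} (φ x)
  -- With trivial centre and trivial edge groups, the star is the free product of copies of `ℚ`.
  let α : Unit →* RatGroup.{u} := 1
  let β : X → Unit →* PUnit.{u + 1} := fun _ => 1
  obtain ⟨p, -, hp⟩ := StarAmalgam.exists_lift (α := α) (β := β) 1 ρ (fun x _ => map_one (ρ x))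
  refine ⟨StarAmalgam α β, inferInstance, StarAmalgam.isTameGroup
    (Function.injective_of_subsingleton _) (fun _ => Function.injective_of_subsingleton _)
    (fun _ _ _ b _ hb => absurd (Subsingleton.elim b 1) hb) RatGroup.isTameGroup
    (fun x hx => absurd (Subsingleton.elim x 1) hx), p,
    fun x => StarAmalgam.leaf α β x (RatGroup.ofInt (Multiplicative.ofAdd 1)), fun x => ?_⟩
  rw [hp, hρ]

/-! ### Uniquely divisible groups as direct limits -/

theorem isUniquelyDivisibleGroup_of_pow {U : Type u} [Group U]
    (hinj : ∀ (n : ℕ) (x y : U), n ≠ 0 → x ^ n = y ^ n → x = y)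
    (hroot : ∀ (n : ℕ) (x : U), n ≠ 0 → ∃ z, z ^ n = x) : IsUniquelyDivisibleGroup U := by
  intro n hn
  have hb : Function.Bijective (fun g : U => g ^ n.natAbs) :=
    ⟨fun x y => hinj _ x y (Int.natAbs_ne_zero.mpr hn),
      fun x => hroot _ x (Int.natAbs_ne_zero.mpr hn)⟩
  rcases Int.natAbs_eq n with h | h
  · rw [h]
    simpa only [zpow_natCast] using hb
  · rw [h]
    simp only [zpow_neg, zpow_natCast]
    exact (Equiv.inv U).bijective.comp hb

section Sequence

variable {S : ℕ → Type u} [∀ n, Group (S n)] (t : ∀ n, S n →* S (n + 1))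

/-- The transition maps of a sequence of groups. -/
def transition (i j : ℕ) (h : i ≤ j) : S i →* S j :=
  Nat.leRecOn (C := fun k => S i →* S k) h (fun {k} f => (t k).comp f) (MonoidHom.id _)

theorem transition_self (i : ℕ) (x : S i) : transition t i i le_rfl x = x := by
  rw [transition, Nat.leRecOn_self]
  rfl

theorem transition_succ (i j : ℕ) (h : i ≤ j) (x : S i) :
    transition t i (j + 1) (h.trans j.le_succ) x = t j (transition t i j h x) := by
  rw [transition, Nat.leRecOn_succ h]
  rfl

instance transition.directedSystem : DirectedSystem S (transition t · · ·) where
  map_self i x := transition_self t i x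
  map_map k j i hij hjk x := by
    induction k, hjk using Nat.le_induction with
    | base => exact transition_self t _ _
    | succ k hjk ih =>
      rw [transition_succ t j k hjk, ih, transition_succ t i k (hij.trans hjk)]

/-- The limit of a sequence of groups over `G` with unique roots in which all elements acquire
roots at the next stage. -/
theorem exists_isUniquelyDivisibleGroup_of_sequence {G : Type v} [Group G] (π : ∀ n, S n →* G)
    (hπ : ∀ n, (π (n + 1)).comp (t n) = π n)
    (hinj : ∀ n (k : ℕ) (x y : S n), k ≠ 0 → x ^ k = y ^ k → x = y)
    (hroot : ∀ n (k : ℕ) (x : S n), k ≠ 0 → ∃ z, z ^ k = t n x) :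
    ∃ (U : Type u) (_ : Group U) (_ : IsUniquelyDivisibleGroup U) (e : S 0 →* U) (p : U →* G),
      p.comp e = π 0 := by
  let U := DirectLimit S (transition t)
  let e : ∀ i, S i →* U := fun i =>
    { toFun := fun x => ⟦⟨i, x⟩⟧
      map_one' := (DirectLimit.one_def (f := transition t) i).symm
      map_mul' := fun x y => (DirectLimit.mul_def (f := transition t) i x y).symm }
  have het : ∀ i j h x, e j (transition t i j h x) = e i x := fun i j h x =>
    DirectLimit.mk_apply (f := transition t) i j x h
  have hπt : ∀ i j h x, π i x = π j (transition t i j h x) := by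
    intro i j h x
    induction j, h using Nat.le_induction with
    | base => rw [transition_self]
    | succ j h ih => rw [ih, transition_succ t i j h, ← hπ j]; rfl
  refine ⟨U, inferInstance, isUniquelyDivisibleGroup_of_pow ?_ ?_, e 0,
    MonoidHom.mk' (DirectLimit.lift (transition t) (fun i x => π i x) hπt) ?_, ?_⟩
  · intro n x y hn hxy
    obtain ⟨i, x, y, rfl, rfl⟩ := DirectLimit.exists_eq_mk₂ (transition t) x y
    change e i x ^ n = e i y ^ n at hxy
    change e i x = e i y
    rw [← map_pow, ← map_pow] at hxy
    obtain ⟨j, h1, h2, h3⟩ := Quotient.exact hxy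
    change transition t i j h1 (x ^ n) = transition t i j h2 (y ^ n) at h3
    rw [map_pow, map_pow] at h3
    rw [← het i j h1, ← het i j h1, hinj j n _ _ hn h3]
  · intro n x hn
    obtain ⟨i, x, rfl⟩ := DirectLimit.exists_eq_mk (transition t) x
    obtain ⟨z, hz⟩ := hroot i n x hn
    refine ⟨e (i + 1) z, ?_⟩
    change _ = e i x
    rw [← map_pow, hz, ← het i (i + 1) i.le_succ, transition_succ t i i le_rfl, transition_self]
  · intro x y
    exact DirectLimit.lift_mul (f := transition t) π hπt x y
  · rfl

end Sequence

/-- A tame group over `G`. -/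
structure TameOver (G : Type v) [Group G] : Type (max (u + 1) v) where
  /-- The underlying group. -/
  carrier : Type u
  [group : Group carrier]
  /-- The structure map. -/
  hom : carrier →* G
  isTameGroup : IsTameGroup carrier

attribute [instance] TameOver.group

/-- Iterate `exists_adjoin_roots` over `G`: roots appear one stage later, and their uniqueness holds
at every stage. -/
theorem IsDivisibleGroup.exists_isUniquelyDivisibleGroup_of_isTameGroup {G : Type v} [Group G]
    (hG : IsDivisibleGroup G) {H : Type u} [Group H] (hH : IsTameGroup H) (π : H →* G) :
    ∃ (U : Type u) (_ : Group U) (_ : IsUniquelyDivisibleGroup U) (e : H →* U) (p : U →* G),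
      p.comp e = π := by
  have hstep : ∀ S : TameOver.{u, v} G, ∃ (S' : TameOver.{u, v} G) (f : S.carrier →* S'.carrier),
      S'.hom.comp f = S.hom ∧ ∀ (n : ℕ) (h : S.carrier), n ≠ 0 → ∃ z, z ^ n = f h := by
    intro S
    obtain ⟨M, _, hM, f, p, hp, hr⟩ := S.isTameGroup.exists_adjoin_roots hG S.hom
    exact ⟨⟨M, p, hM⟩, f, hp, hr⟩
  choose next f hf hr using hstep
  let S : ℕ → TameOver.{u, v} G := fun n =>
    Nat.rec (motive := fun _ => TameOver.{u, v} G) ⟨H, π, hH⟩ (fun _ S => next S) n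
  exact exists_isUniquelyDivisibleGroup_of_sequence (S := fun n => (S n).carrier)
    (fun n : ℕ => (f (S n) : (S n).carrier →* (S (n + 1)).carrier)) (fun n => (S n).hom)
    (fun n => hf (S n))
    (fun n k x y hk h => (S n).isTameGroup.pow_left_injective hk h) (fun n k x hk => hr (S n) k x hk)

/-- Every map from a set to a divisible group factors through a uniquely divisible group. -/
theorem IsDivisibleGroup.exists_isUniquelyDivisibleGroup {G : Type v} [Group G]
    (hG : IsDivisibleGroup G) {X : Type u} (φ : X → G) :
    ∃ (U : Type u) (_ : Group U) (_ : IsUniquelyDivisibleGroup U) (p : U →* G) (s : X → U),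
      ∀ x, p (s x) = φ x := by
  obtain ⟨H, _, hH, π, s, hs⟩ := hG.exists_isTameGroup φ
  obtain ⟨U, _, hU, e, p, hp⟩ := hG.exists_isUniquelyDivisibleGroup_of_isTameGroup hH π
  exact ⟨U, _, hU, p, fun x => e (s x), fun x => by rw [← hs, ← hp]; rfl⟩

/-! ### Subquotients and the conclusion -/

theorem IsSubquotient.of_le_range {K : Type u} {G : Type v} [Group K] [Group G] (f : K →* G)
    {R : Subgroup G} (hR : R ≤ f.range) : IsSubquotient R K := by
  let g : R.comap f →* R := f.subgroupComap R
  have hg : Function.Surjective g := by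
    rintro ⟨y, hy⟩
    obtain ⟨x, rfl⟩ := hR hy
    exact ⟨⟨x, hy⟩, rfl⟩
  exact ⟨R.comap f, g.ker, inferInstance, ⟨QuotientGroup.quotientKerEquivOfSurjective g hg⟩⟩

theorem mainTheorem2 {X : Type u} {G : Type v} [Group G] (hG : IsDivisibleGroup G)
    (φ : X → G) (hφ : ∀ x, IsOfFinOrder (φ x)) :
    IsSubquotient (Subgroup.closure (Set.range φ)) (CBau (FreeGroup X)) := by
  obtain ⟨U, _, hU, p, s, hs⟩ := hG.exists_isUniquelyDivisibleGroup φ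
  obtain ⟨E, hE, -⟩ := Bau.existsUnique_lift hU
    (FreeGroup.lift fun x => s x ^ orderOf (φ x) : FreeGroup X →* U)
  have hEx : ∀ x, E (Bau.eta _ (FreeGroup.of x)) = s x ^ orderOf (φ x) := fun x => by
    rw [← MonoidHom.comp_apply, hE, FreeGroup.lift_apply_of]
  have hker : Subgroup.normalClosure ((Bau.eta (FreeGroup X)).range : Set (Bau (FreeGroup X))) ≤
      (p.comp E).ker := by
    have htriv : (p.comp E).comp (Bau.eta (FreeGroup X)) = 1 := by
      ext x
      change p (E (Bau.eta _ (FreeGroup.of x))) = 1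
      rw [hEx, map_pow, hs, pow_orderOf_eq_one]
    refine Subgroup.normalClosure_le_normal ?_
    rintro _ ⟨w, rfl⟩
    exact DFunLike.congr_fun htriv w
  refine IsSubquotient.of_le_range (QuotientGroup.lift _ (p.comp E) hker) ?_
  rw [Subgroup.closure_le]
  rintro _ ⟨x, rfl⟩
  have hn : ((orderOf (φ x) : ℕ) : ℤ) ≠ 0 := by exact_mod_cast (hφ x).orderOf_pos.ne'
  obtain ⟨y, hy⟩ := (Bau.isUniquelyDivisible (FreeGroup X) _ hn).surjective
    (Bau.eta _ (FreeGroup.of x))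
  -- Both sides have the same power of exponent `orderOf (φ x)`, and roots in `U` are unique.
  have hEy : E y = s x := by
    refine (hU _ hn).injective ?_
    simp only at hy ⊢
    rw [← map_zpow, hy, hEx, zpow_natCast]
  refine ⟨(y : CBau (FreeGroup X)), ?_⟩
  rw [← hs, ← hEy]
  rfl
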